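/- Notation. Let $f(u)=u^3-3u$. For $a\in\mathbb{C}$ with $a\neq 1$ let $\Delta_a=B(a,|a-1|)$, $\Omega_a=f(\Delta_a)$ and $f_a(z)=f(a+(1-a)z)$, extended to $\widehat{\mathbb{C}}$ by $f_a(\infty)=\infty$, and let $\iota(z)=1/\overline{z}$ be the reflection in the unit circle. Let $S$ be the set of $a\neq 1$ with $\frac32<\mathrm{Re}(a)<4$ such that $f(\partial\Delta_a)$ is a Jordan curve. For $a\in S$ the map $f_a$ is injective on $\overline{\mathbb{D}}$ with $f_a(\overline{\mathbb{D}})=\overline{\Omega_a}$, and the Schwarz reflection map of $\Omega_a$ is $\sigma_a=f_a\circ\iota\circ(f_a|_{\overline{\mathbb{D}}})^{-1}:\overline{\Omega_a}\to\widehat{\mathbb{C}}$. Put $T_a^0=(\widehat{\mathbb{C}}\setminus\Omega_a)\setminus\{-2\}$, $T_a^\infty=\bigcup_{n\ge 0}\sigma_a^{-n}(T_a^0)$ (the tiling set), $\widetilde{T_a^\infty}=f_a^{-1}(T_a^\infty)$ (the lifted tiling set), and $\mathcal{C}(\mathcal{S})=\{a\in S: 2\notin T_a^\infty\}$. Let $\widetilde{\sigma_a}^*\subset\widehat{\mathbb{C}}\times\widehat{\mathbb{C}}$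 be the $2:2$ correspondence $$(z,w)\in\widetilde{\sigma_a}^*\iff \frac{f_a(w)-f_a(\iota(z))}{w-\iota(z)}=0,$$ where the quotient is read as a polynomial of bidegree $(2,2)$ in $(\iota(z),w)$ on $\widehat{\mathbb{C}}\times\widehat{\mathbb{C}}$ (so its value at $w=\iota(z)\in\mathbb{C}$ is $f_a'(w)$, and its only zero with an infinite coordinate is $\iota(z)=w=\infty$). The grand orbit of a point is its class under the equivalence relation on $\widehat{\mathbb{C}}$ generated by $\widetilde{\sigma_a}^*$. Proposition. Let $a\in\mathcal{C}(\mathcal{S})$. Then $\iota$ restricts to a homeomorphism of $\widetilde{T_a^\infty}$, and there is a homeomorphism $\tau_a$ of $\widetilde{T_a^\infty}$ of order $3$ with $f_a\circ\tau_a=f_a$ (a deck transformation of order three). For every such $\tau_a$: 1. On $\widetilde{T_a^\infty}$ the correspondence consists of the two maps $\tau_a\circ\iota$ and $\tau_a^{\circ 2}\circ\iota$: for $z\in\widetilde{T_a^\infty}$ and $w\in\widehat{\mathbb{C}}$, $(z,w)\in\widetilde{\sigma_a}^*$ if and only if $w=\tau_a(\iota(z))$ or $w=\tau_a^{\circ 2}(\iota(z))$.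 2. For each $z\in\widetilde{T_a^\infty}$, the grand orbit of $z$ under $\widetilde{\sigma_a}^*$ equals the orbit of $z$ under the group $\langle\iota,\tau_a\rangle$ of homeomorphisms of $\widetilde{T_a^\infty}$. 3. The group $\langle\iota,\tau_a\rangle$ is the free product $\langle\iota\rangle\ast\langle\tau_a\rangle$ of its subgroups $\langle\iota\rangle$ and $\langle\tau_a\rangle$, and there is an isomorphism $\mathbb{Z}_2\ast\mathbb{Z}_3\to\langle\iota,\tau_a\rangle$ that sends the standard generators of $\mathbb{Z}_2$ and $\mathbb{Z}_3$ to $\iota$ and $\tau_a$. -/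

import Mathlib

open scoped ComplexConjugate

noncomputable section

namespace SchwarzFamily

/-- The Riemann sphere, as the one-point compactification of the plane. -/
abbrev Sphere : Type := OnePoint ℂ

/-- The cubic Chebyshev polynomial `f(u) = u³ - 3u`. -/
def cheb (u : ℂ) : ℂ := u ^ 3 - 3 * u

/-- A Jordan curve in the plane: the image of a circle under an injective continuous map. -/
def IsJordanCurve (C : Set ℂ) : Prop :=
  ∃ γ : Circle → ℂ, Continuous γ ∧ Function.Injective γ ∧ Set.range γ = C

/-- The open disk `Δ_a = B(a, |a - 1|)`. -/
def diskΔ (a : ℂ) : Set ℂ := Metric.ball a ‖a - 1‖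

/-- The parameters `a` with `Re a > 0`, `a ≠ 1`, for which `f(∂Δ_a)` is a Jordan curve. -/
def paramHat : Set ℂ :=
  {a | 0 < a.re ∧ a ≠ 1 ∧ IsJordanCurve (cheb '' frontier (diskΔ a))}

/-- The parameter space `S`: those `a ∈ Ŝ` with `3/2 < Re a < 4`. -/
def paramS : Set ℂ := {a | a ∈ paramHat ∧ 3 / 2 < a.re ∧ a.re < 4}

/-- The quadrature domain `Ω_a = f(Δ_a)`, as a subset of the plane. -/
def domainΩ (a : ℂ) : Set ℂ := cheb '' diskΔ a

/-- The polynomial `f_a(z) = f(a + (1 - a) z)`. -/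
def chebA (a z : ℂ) : ℂ := cheb (a + (1 - a) * z)

/-- `f_a` as a self-map of the sphere, with `f_a(∞) = ∞`. -/
def chebSphere (a : ℂ) : Sphere → Sphere := OnePoint.map (chebA a)

/-- Reflection `z ↦ 1 / conj z` in the unit circle; it exchanges `0` and `∞`. -/
def reflect : Sphere → Sphere
  | none => ((0 : ℂ) : Sphere)
  | some z => if z = 0 then OnePoint.infty else (((conj z)⁻¹ : ℂ) : Sphere)

/-- The Schwarz reflection map `σ_a = f_a ∘ ι ∘ (f_a|closed unit disk)⁻¹` of `Ω_a`.
Only its values on the closure of `Ω_a` are ever used. -/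
def schwarz (a w : ℂ) : Sphere :=
  chebSphere a (reflect
    ((Function.invFunOn (chebA a) (Metric.closedBall (0 : ℂ) 1) w : ℂ) : Sphere))

/-- The desingularized droplet `T_a⁰`: the complement of `Ω_a` in the sphere, without the
cusp `-2`. -/
def droplet (a : ℂ) : Set Sphere :=
  ((fun w : ℂ => (w : Sphere)) '' domainΩ a)ᶜ \ {((-2 : ℂ) : Sphere)}

/-- `σ_a^{-n}(T_a⁰)`, where `σ_a` has domain the closure of `Ω_a`. -/
def tileLevel (a : ℂ) : ℕ → Set Sphere
  | 0 => droplet a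
  | n + 1 => (fun w : ℂ => (w : Sphere)) '' {w | w ∈ closure (domainΩ a) ∧
      schwarz a w ∈ tileLevel a n}

/-- The tiling set `T_a^∞`. -/
def tilingSet (a : ℂ) : Set Sphere := ⋃ n : ℕ, tileLevel a n

/-- The connectedness locus: the parameters in `S` whose critical value `2` does not escape. -/
def connLocus : Set ℂ := {a | a ∈ paramS ∧ ((2 : ℂ) : Sphere) ∉ tilingSet a}

/-- The lifted tiling set `f_a⁻¹(T_a^∞)`. -/
def liftedTiling (a : ℂ) : Set Sphere := chebSphere a ⁻¹' tilingSet a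

/-- The relation `(f_a(w) - f_a(p)) / (w - p) = 0` on the sphere. For finite `p`, `w` the
quotient is the divided difference of the polynomial `f_a` (its value at `w = p` is the
derivative). It is a polynomial of bidegree `(2, 2)` in `(p, w)` with leading part a multiple of
`p² + p w + w²`, so that the only point at infinity of its zero set is `(∞, ∞)`. -/
def dividedZero (a : ℂ) : Sphere → Sphere → Prop
  | none, none => True
  | none, some _ => False
  | some _, none => False
  | some p, some w => dslope (chebA a) p w = 0

/-- The `2:2` correspondence `σ̃_a^*`: `(z, w)` belongs to it if and only if
`(f_a(w) - f_a(ι z)) / (w - ι z) = 0`. -/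
def corr (a : ℂ) (z w : Sphere) : Prop := dividedZero a (reflect z) w

/-- The grand orbit of `z` under the correspondence: the points reachable from `z` by finitely
many forward and backward steps. -/
def grandOrbit (a : ℂ) (z : Sphere) : Set Sphere := {w | Relation.EqvGen (corr a) z w}

/-- `τ` is a deck transformation of order three of `f_a : f_a⁻¹(T_a^∞) → T_a^∞`. -/
def IsOrderThreeDeck (a : ℂ) (τ : liftedTiling a ≃ₜ liftedTiling a) : Prop :=
  (∀ z : liftedTiling a, chebSphere a (τ z : Sphere) = chebSphere a (z : Sphere)) ∧
    orderOf τ = 3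

end SchwarzFamily

end

open SchwarzFamily

/-!
Write `g = f_a`. Two points `x ≠ y` have the same image under `g` exactly when `sib a x y = 0`,
where `sib` is the divided difference, a quadratic polynomial; it vanishes on the diagonal only at
the two critical points. The correspondence is `sib a (ι z) w = 0`, so the theorem amounts to the
existence of a continuous choice of siblings on the lifted tiling set, to the fact that this choice
is unique up to inversion, and to a ping-pong argument.

*Univalence.* If `g` maps the unit circle onto a Jordan curve, then `g` is injective on the circle
(`injOn_sphere`): the cusp `-2` has the single preimage `1`, so after cutting there `g` becomes a
locally injective continuous map of the real line into itself. Injectivity on the closed disk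
(`injOn_closedBall`) follows by connectedness arguments for the set of points having a sibling in
the disk; the condition `Re a < 4` enters as the position of siblings near the cusp. Hence
`σ_a(g(z)) = g(ι(z))` on the closed disk, and the finite part of the tiling set is the increasing
union of sets `escSet a n` defined by this recursion.

*Connectedness.* Each `escSet a n` is connected (`isPreconnected_escSet`). The complement of `Ω_a`
without the cusp is connected because its boundary is the image of an open arc; preimages of
connected sets under `g` are connected because `g` is totally ramified at infinity; and level
`n + 1` is obtained by folding the preimage of level `n` into the disk. Therefore the lifted tiling
set without `∞` is connected, and a deck transformation of order three has no finite fixed point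
(`IsOrderThreeDeck.apply_ne`). A fiber has three points, so `τ x` and `τ² x` are the two siblings
of `x`.

*Existence of a deck transformation.* The siblings of `u` are `(-u ± √(12 - 3u²)) / 2`, so what is
needed is a square root of `(w + 2) / (w - 2)` on the tiling set. It exists on the complement of
any path from `2` to `-2` (`exists_sqrt_of_joinedIn`). Such a path exists in the complement of each
`escSet a n`: this complement is path connected (`joinedIn_stayDisk`), since the next one is
obtained from it by a double cover branched over the critical value `2`, which does not escape,
followed by the reflection. The square roots on the various levels agree after normalization at a
base point, and they glue because each level lies in the interior of the next one
(`escSet_subset_interior`).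

*The group.* The reflection exchanges the open disk and its exterior, and by univalence `τ` and
`τ²` carry the part of the lifted tiling set in the open disk to the exterior. The ping-pong lemma
(`free_product_of_ping_pong`) gives the free product.
-/

namespace SchwarzFamily

open Set Filter Topology

/-! ### The affine coordinate and siblings -/

/-- The affine map `z ↦ a + (1 - a) z`, carrying the unit disk onto `Δ_a`. -/
def affA (a z : ℂ) : ℂ := a + (1 - a) * z

/-- The divided difference of `f` in the coordinate `affA a`. Off the diagonal its zeros are the
pairs of distinct points with the same image under `f_a`; on the diagonal they are the critical
points. -/
def sib (a x y : ℂ) : ℂ := affA a x ^ 2 + affA a x * affA a y + affA a y ^ 2 - 3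

lemma chebA_eq (a z : ℂ) : chebA a z = affA a z ^ 3 - 3 * affA a z := rfl

lemma chebA_sub (a x y : ℂ) : chebA a x - chebA a y = (1 - a) * (x - y) * sib a x y := by
  simp only [chebA_eq, sib, affA]; ring

lemma sib_comm (a x y : ℂ) : sib a x y = sib a y x := by simp only [sib]; ring

lemma chebA_eq_of_sib {a x y : ℂ} (h : sib a x y = 0) : chebA a x = chebA a y := by
  have := chebA_sub a x y
  rw [h, mul_zero] at this
  exact sub_eq_zero.1 this

lemma sib_eq_zero {a x y : ℂ} (ha : a ≠ 1) (h : chebA a x = chebA a y) (hxy : x ≠ y) :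
    sib a x y = 0 := by
  have := chebA_sub a x y
  rw [h, sub_self] at this
  have h1 : (1 - a) * (x - y) ≠ 0 := mul_ne_zero (sub_ne_zero.2 ha.symm) (sub_ne_zero.2 hxy)
  exact (mul_eq_zero.1 this.symm).resolve_left h1

@[fun_prop]
lemma continuous_affA (a : ℂ) : Continuous (affA a) := by unfold affA; fun_prop

@[fun_prop]
lemma continuous_chebA (a : ℂ) : Continuous (chebA a) := by unfold chebA cheb; fun_prop

lemma continuous_sib (a : ℂ) : Continuous fun p : ℂ × ℂ => sib a p.1 p.2 := by
  unfold sib; fun_prop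

lemma affA_injective {a : ℂ} (ha : a ≠ 1) : Function.Injective (affA a) := by
  intro x y h
  have h1 : (1 - a) * (x - y) = 0 := by simp only [affA] at h; linear_combination h
  exact sub_eq_zero.1 ((mul_eq_zero.1 h1).resolve_left (sub_ne_zero.2 ha.symm))

lemma affA_one (a : ℂ) : affA a 1 = 1 := by simp [affA]

/-- The inverse of the affine coordinate. -/
noncomputable def affInv (a u : ℂ) : ℂ := (u - a) / (1 - a)

lemma affA_affInv {a : ℂ} (ha : a ≠ 1) (u : ℂ) : affA a (affInv a u) = u := by
  have : 1 - a ≠ 0 := sub_ne_zero.2 ha.symm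
  simp only [affA, affInv]; field_simp; ring

@[fun_prop]
lemma continuous_affInv (a : ℂ) : Continuous (affInv a) := by unfold affInv; fun_prop

lemma norm_affA_sub (a z : ℂ) : ‖affA a z - a‖ = ‖a - 1‖ * ‖z‖ := by
  rw [show affA a z - a = (1 - a) * z by simp [affA], norm_mul, norm_sub_rev]

lemma norm_affInv (a u : ℂ) : ‖affInv a u‖ = ‖u - a‖ / ‖a - 1‖ := by
  rw [affInv, norm_div, norm_sub_rev 1 a]

lemma affInv_lt_one_iff {a : ℂ} (ha : a ≠ 1) (u : ℂ) : ‖affInv a u‖ < 1 ↔ ‖u - a‖ < ‖a - 1‖ := by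
  rw [norm_affInv, div_lt_one (norm_pos_iff.2 (sub_ne_zero.2 ha))]

/-- The circle `∂Δ_a` meets the real line at `1` and `2 Re a - 1`; real points not between them lie
outside the closed disk. -/
lemma norm_lt_real_sub {a : ℂ} (x : ℝ) (h : 0 < (x - 1) * (x + 1 - 2 * a.re)) :
    ‖a - 1‖ < ‖(x : ℂ) - a‖ := by
  apply lt_of_pow_lt_pow_left₀ 2 (norm_nonneg _)
  rw [← Complex.normSq_eq_norm_sq, ← Complex.normSq_eq_norm_sq, Complex.normSq_apply,
    Complex.normSq_apply]
  simp
  nlinarith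

lemma real_sub_norm_lt {a : ℂ} (x : ℝ) (h : (x - 1) * (x + 1 - 2 * a.re) < 0) :
    ‖(x : ℂ) - a‖ < ‖a - 1‖ := by
  apply lt_of_pow_lt_pow_left₀ 2 (norm_nonneg _)
  rw [← Complex.normSq_eq_norm_sq, ← Complex.normSq_eq_norm_sq, Complex.normSq_apply,
    Complex.normSq_apply]
  simp
  nlinarith

/-- The critical point `-1` lies outside the closed disk. -/
lemma one_lt_norm_of_affA_eq_neg_one {a z : ℂ} (h0 : 0 < a.re) (h : affA a z = -1) : 1 < ‖z‖ := by
  have h1 := norm_affA_sub a z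
  have h2 := norm_lt_real_sub (a := a) (-1) (by nlinarith)
  rw [h] at h1
  push_cast at h2
  rw [h1] at h2
  by_contra hz
  have := mul_le_mul_of_nonneg_left (not_lt.1 hz) (norm_nonneg (a - 1))
  linarith

lemma one_lt_norm_of_affA_eq_neg_two {a z : ℂ} (h0 : 0 < a.re) (h : affA a z = -2) : 1 < ‖z‖ := by
  have h1 := norm_affA_sub a z
  have h2 := norm_lt_real_sub (a := a) (-2) (by nlinarith)
  rw [h] at h1
  push_cast at h2
  rw [h1] at h2
  by_contra hz
  have := mul_le_mul_of_nonneg_left (not_lt.1 hz) (norm_nonneg (a - 1))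
  linarith

lemma sib_self {a z : ℂ} (h : sib a z z = 0) : affA a z = 1 ∨ affA a z = -1 := by
  have : (affA a z - 1) * (affA a z + 1) = 0 := by
    simp only [sib] at h; linear_combination h / 3
  rcases mul_eq_zero.1 this with h | h
  · exact Or.inl (sub_eq_zero.1 h)
  · exact Or.inr (eq_neg_of_add_eq_zero_left h)

lemma sib_self_of_norm_le {a z : ℂ} (ha : a ≠ 1) (h0 : 0 < a.re) (hz : ‖z‖ ≤ 1)
    (h : sib a z z = 0) : z = 1 := by
  rcases sib_self h with h | h
  · exact affA_injective ha (h.trans (affA_one a).symm)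
  · exact absurd (one_lt_norm_of_affA_eq_neg_one h0 h) (not_lt.2 hz)

lemma chebA_one (a : ℂ) : chebA a 1 = -2 := by rw [chebA_eq, affA_one]; norm_num

lemma chebA_eq_neg_two {a z : ℂ} (ha : a ≠ 1) (h : chebA a z = -2) :
    z = 1 ∨ affA a z = -2 := by
  have : (affA a z - 1) ^ 2 * (affA a z + 2) = 0 := by rw [chebA_eq] at h; linear_combination h
  rcases mul_eq_zero.1 this with h | h
  · left
    exact affA_injective ha ((sub_eq_zero.1 (pow_eq_zero_iff two_ne_zero |>.1 h)).trans
      (affA_one a).symm)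
  · exact Or.inr (eq_neg_of_add_eq_zero_left h)

lemma chebA_eq_neg_two_of_norm_le {a z : ℂ} (ha : a ≠ 1) (h0 : 0 < a.re) (hz : ‖z‖ ≤ 1)
    (h : chebA a z = -2) : z = 1 := by
  rcases chebA_eq_neg_two ha h with h | h
  · exact h
  · exact absurd (one_lt_norm_of_affA_eq_neg_two h0 h) (not_lt.2 hz)

lemma affA_image_ball {a : ℂ} (ha : a ≠ 1) : affA a '' Metric.ball 0 1 = diskΔ a := by
  ext u
  simp only [diskΔ, mem_image, mem_ball_iff_norm, sub_zero]
  constructor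
  · rintro ⟨z, hz, rfl⟩
    rw [norm_affA_sub]
    exact mul_lt_of_lt_one_right (norm_pos_iff.2 (sub_ne_zero.2 ha)) hz
  · intro h
    exact ⟨affInv a u, (affInv_lt_one_iff ha u).2 h, affA_affInv ha u⟩

lemma affA_image_sphere {a : ℂ} (ha : a ≠ 1) :
    affA a '' Metric.sphere 0 1 = frontier (diskΔ a) := by
  have hp : 0 < ‖a - 1‖ := norm_pos_iff.2 (sub_ne_zero.2 ha)
  rw [diskΔ, frontier_ball _ hp.ne']
  ext u
  simp only [mem_image, mem_sphere_iff_norm, sub_zero]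
  constructor
  · rintro ⟨z, hz, rfl⟩
    rw [norm_affA_sub, hz, mul_one]
  · intro h
    exact ⟨affInv a u, by rw [norm_affInv, h, div_self hp.ne'], affA_affInv ha u⟩

lemma domainΩ_eq {a : ℂ} (ha : a ≠ 1) : domainΩ a = chebA a '' Metric.ball 0 1 := by
  rw [domainΩ, ← affA_image_ball ha, image_image]; rfl

lemma cheb_image_frontier {a : ℂ} (ha : a ≠ 1) :
    cheb '' frontier (diskΔ a) = chebA a '' Metric.sphere 0 1 := by
  rw [← affA_image_sphere ha, image_image]; rfl

/-! ### Injectivity on the unit circle -/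

/-- A parametrization of the unit circle without `1` by the real line: the line `Re X = 1/2` in
the coordinate `X = 1 / (1 - z)`. -/
noncomputable def circPt (η : ℝ) : ℂ := 1 - 1 / (1 / 2 + η * Complex.I)

lemma half_add_ne (η : ℝ) : (1 / 2 + η * Complex.I : ℂ) ≠ 0 := by
  intro h
  have := congrArg Complex.re h
  simp at this

lemma one_sub_circPt_inv (η : ℝ) : (1 - circPt η)⁻¹ = 1 / 2 + η * Complex.I := by
  simp [circPt]

lemma circPt_ne_one (η : ℝ) : circPt η ≠ 1 := by
  intro h
  have := one_sub_circPt_inv η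
  rw [h, sub_self, inv_zero] at this
  exact half_add_ne η this.symm

/-- In the coordinate `1 / (1 - z)` the unit disk is the half-plane `Re > 1/2`. -/
lemma norm_lt_one_iff_re {z : ℂ} (hz : z ≠ 1) : ‖z‖ < 1 ↔ 1 / 2 < ((1 - z)⁻¹).re := by
  have h1 : 0 < Complex.normSq (1 - z) := Complex.normSq_pos.2 (sub_ne_zero.2 hz.symm)
  rw [Complex.inv_re, lt_div_iff₀ h1, ← sq_lt_one_iff₀ (norm_nonneg z),
    ← Complex.normSq_eq_norm_sq, Complex.normSq_apply, Complex.normSq_apply]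
  simp
  constructor <;> intro h <;> nlinarith

lemma norm_eq_one_iff_re {z : ℂ} (hz : z ≠ 1) : ‖z‖ = 1 ↔ ((1 - z)⁻¹).re = 1 / 2 := by
  have h1 : 0 < Complex.normSq (1 - z) := Complex.normSq_pos.2 (sub_ne_zero.2 hz.symm)
  rw [Complex.inv_re, div_eq_iff h1.ne', ← sq_eq_sq₀ (norm_nonneg z) zero_le_one,
    ← Complex.normSq_eq_norm_sq, Complex.normSq_apply, Complex.normSq_apply]
  simp
  constructor <;> intro h <;> nlinarith

lemma norm_circPt (η : ℝ) : ‖circPt η‖ = 1 := by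
  rw [norm_eq_one_iff_re (circPt_ne_one η), one_sub_circPt_inv]; simp

lemma exists_circPt {z : ℂ} (hz : ‖z‖ = 1) (h1 : z ≠ 1) : ∃ η, circPt η = z := by
  refine ⟨((1 - z)⁻¹).im, ?_⟩
  have h2 := (norm_eq_one_iff_re h1).1 hz
  have h3 : (1 / 2 + ((1 - z)⁻¹).im * Complex.I : ℂ) = (1 - z)⁻¹ := by
    apply Complex.ext
    · simp only [Complex.add_re, Complex.re_ofReal_mul, Complex.I_re, mul_zero, add_zero, h2]
      norm_num
    · simp
  rw [circPt, h3, one_div, inv_inv]; ring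

lemma circPt_injective : Function.Injective circPt := by
  intro x y h
  have h1 := one_sub_circPt_inv x
  rw [h, one_sub_circPt_inv y] at h1
  have := congrArg Complex.im h1
  simpa using this.symm

@[fun_prop]
lemma continuous_circPt : Continuous circPt := by
  unfold circPt
  exact continuous_const.sub (continuous_const.div (by fun_prop) half_add_ne)

/-- At a local extremum, which exists between two points with the same value, a continuous function
is not injective. -/
lemma injective_of_locally_injective {G : ℝ → ℝ} (hG : Continuous G)
    (hl : ∀ x, ∃ U ∈ 𝓝 x, InjOn G U) : Function.Injective G := by
  have key : ∀ x y, x < y → G x ≠ G y := by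
    intro x y hxy h
    obtain ⟨c, -, hc⟩ := exists_isLocalExtr_Ioo hxy hG.continuousOn h
    obtain ⟨U, hU, hUi⟩ := hl c
    obtain ⟨ε, hε, hεU⟩ := Metric.nhds_basis_closedBall.mem_iff.1 hU
    rw [Real.closedBall_eq_Icc] at hεU
    have hle : c - ε ≤ c + ε := by linarith
    have hmono := hG.continuousOn.strictMonoOn_of_injOn_Icc' hle (hUi.mono hεU)
    have hnear : ∀ᶠ t in 𝓝 c, t ∈ Ioo (c - ε) (c + ε) := Ioo_mem_nhds (by linarith) (by linarith)
    have hcm : c ∈ Icc (c - ε) (c + ε) := ⟨by linarith, by linarith⟩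
    -- points close to `c` on either side of it
    have pick : ∀ P : ℝ → Prop, (∀ᶠ t in 𝓝 c, P t) →
        (∃ t ∈ Icc (c - ε) (c + ε), t < c ∧ P t) ∧ ∃ t ∈ Icc (c - ε) (c + ε), c < t ∧ P t := by
      intro P hP
      constructor
      · obtain ⟨t, ⟨h1, h2⟩, h3⟩ := (((hP.and hnear).filter_mono nhdsWithin_le_nhds).and
          (self_mem_nhdsWithin (a := c) (s := Iio c))).exists
        exact ⟨t, ⟨h2.1.le, h2.2.le⟩, h3, h1⟩
      · obtain ⟨t, ⟨h1, h2⟩, h3⟩ := (((hP.and hnear).filter_mono nhdsWithin_le_nhds).and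
          (self_mem_nhdsWithin (a := c) (s := Ioi c))).exists
        exact ⟨t, ⟨h2.1.le, h2.2.le⟩, h3, h1⟩
    rcases hc with hc | hc <;> obtain ⟨⟨t, ht, htc, h1⟩, t', ht', htc', h2⟩ := pick _ hc <;>
      rcases hmono with hm | hm
    · exact absurd (hm ht hcm htc) (not_lt.2 h1)
    · exact absurd (hm hcm ht' htc') (not_lt.2 h2)
    · exact absurd (hm hcm ht' htc') (not_lt.2 h2)
    · exact absurd (hm ht hcm htc) (not_lt.2 h1)
  intro x y h
  by_contra hne
  rcases lt_or_gt_of_ne hne with h1 | h1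
  · exact key _ _ h1 h
  · exact key _ _ h1 h.symm

/-- A point that is not critical has a neighborhood without siblings, so that `f_a` is injective
there. -/
lemma exists_nhds_sib_ne {a z : ℂ} (h : sib a z z ≠ 0) :
    ∃ U ∈ 𝓝 z, ∀ x ∈ U, ∀ y ∈ U, sib a x y ≠ 0 := by
  have h1 : {p : ℂ × ℂ | sib a p.1 p.2 ≠ 0} ∈ 𝓝 (z, z) :=
    (isOpen_ne_fun (continuous_sib a) continuous_const).mem_nhds h
  rw [nhds_prod_eq] at h1
  obtain ⟨U, hU, h2⟩ := mem_prod_same_iff.1 h1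
  refine ⟨U, hU, fun x hx y hy => ?_⟩
  have h3 : (x, y) ∈ {p : ℂ × ℂ | sib a p.1 p.2 ≠ 0} := h2 (mk_mem_prod hx hy)
  exact h3

open scoped ComplexOrder in
/-- If `f(∂Δ_a)` is a Jordan curve then `f_a` is injective on the circle. The cusp `-2` has a
single preimage on the circle; cutting domain and target there turns `f_a` into a locally
injective map of the real line to itself, which is injective. -/
theorem injOn_sphere {a : ℂ} (ha : a ≠ 1) (h0 : 0 < a.re)
    (hJ : IsJordanCurve (cheb '' frontier (diskΔ a))) :
    InjOn (chebA a) (Metric.sphere 0 1) := by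
  rw [cheb_image_frontier ha] at hJ
  obtain ⟨γ, hγ, hγi, hγr⟩ := hJ
  have hmem : ∀ z : ℂ, ‖z‖ = 1 → ∃ θ, γ θ = chebA a z := by
    intro z hz
    have : chebA a z ∈ range γ := hγr ▸ ⟨z, by simpa using hz, rfl⟩
    exact this
  obtain ⟨θ₀, hθ₀⟩ := hmem 1 (by simp)
  rw [chebA_one] at hθ₀
  choose θ hθ using fun η => hmem (circPt η) (norm_circPt η)
  have hemb : IsEmbedding γ := (hγ.isClosedEmbedding hγi).isEmbedding
  have hθc : Continuous θ := by
    rw [hemb.continuous_iff]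
    have : γ ∘ θ = fun η => chebA a (circPt η) := funext hθ
    rw [this]; fun_prop
  have hθne : ∀ η, θ η ≠ θ₀ := by
    intro η h
    have h1 := hθ η
    rw [h, hθ₀] at h1
    exact circPt_ne_one η (chebA_eq_neg_two_of_norm_le ha h0 (norm_circPt η).le h1.symm)
  -- cut the target circle at the cusp, by the argument of `-θ / θ₀`
  let G : ℝ → ℝ := fun η => Complex.arg (-((θ η / θ₀ : Circle) : ℂ))
  have hslit : ∀ η, -((θ η / θ₀ : Circle) : ℂ) ∈ Complex.slitPlane := by
    intro η
    rw [Complex.mem_slitPlane_iff_not_le_zero]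
    intro hle
    have h2 : ((θ η / θ₀ : Circle) : ℂ) = 1 := by
      have h3 := Complex.eq_coe_norm_of_nonneg (neg_nonpos.1 hle)
      rw [h3, Circle.norm_coe]; simp
    have h3 : θ η / θ₀ = 1 := by ext; simpa using h2
    exact hθne η (div_eq_one.1 h3)
  have hGc : Continuous G := by
    rw [continuous_iff_continuousAt]
    intro η
    have h1 : ContinuousAt (fun η => -((θ η / θ₀ : Circle) : ℂ)) η := by fun_prop
    exact ContinuousAt.comp (f := fun η => -((θ η / θ₀ : Circle) : ℂ))
      (Complex.continuousAt_arg (hslit η)) h1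
  have hGθ : ∀ η η', G η = G η' → chebA a (circPt η) = chebA a (circPt η') := by
    intro η η' h
    have h1 : -((θ η / θ₀ : Circle) : ℂ) = -((θ η' / θ₀ : Circle) : ℂ) :=
      Complex.ext_norm_arg (by rw [norm_neg, norm_neg, Circle.norm_coe, Circle.norm_coe]) h
    have h2 : θ η / θ₀ = θ η' / θ₀ := by ext; simpa using h1
    rw [← hθ, ← hθ, div_left_inj.1 h2]
  have hGi : Function.Injective G := by
    apply injective_of_locally_injective hGc
    intro η
    have h1 : sib a (circPt η) (circPt η) ≠ 0 := fun h =>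
      circPt_ne_one η (sib_self_of_norm_le ha h0 (norm_circPt η).le h)
    obtain ⟨U, hU, hU'⟩ := exists_nhds_sib_ne h1
    refine ⟨circPt ⁻¹' U, continuous_circPt.continuousAt hU, ?_⟩
    intro x hx y hy hxy
    by_contra hne
    exact hU' _ hx _ hy (sib_eq_zero ha (hGθ _ _ hxy) (circPt_injective.ne hne))
  intro x hx y hy hxy
  have hx' : ‖x‖ = 1 := by simpa using hx
  have hy' : ‖y‖ = 1 := by simpa using hy
  by_cases h1 : x = 1
  · subst h1
    rw [chebA_one] at hxy
    exact (chebA_eq_neg_two_of_norm_le ha h0 hy'.le hxy.symm).symm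
  by_cases h2 : y = 1
  · subst h2
    rw [chebA_one] at hxy
    exact (chebA_eq_neg_two_of_norm_le ha h0 hx'.le hxy)
  obtain ⟨η, rfl⟩ := exists_circPt hx' h1
  obtain ⟨η', rfl⟩ := exists_circPt hy' h2
  have h3 : γ (θ η) = γ (θ η') := by rw [hθ, hθ, hxy]
  have h4 : G η = G η' := by simp only [G, hγi h3]
  rw [hGi h4]

/-! ### Univalence on the closed disk -/

lemma isClosed_setOf_exists_zero {X : Type*} [TopologicalSpace X] {K : Set ℂ} (hK : IsCompact K)
    {F : X × ℂ → ℂ} (hF : Continuous F) : IsClosed {x | ∃ y ∈ K, F (x, y) = 0} := by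
  have : CompactSpace K := isCompact_iff_compactSpace.1 hK
  have h1 : IsClosed {p : X × K | F (p.1, p.2) = 0} :=
    isClosed_eq (hF.comp (by fun_prop)) continuous_const
  have h2 := isClosedMap_fst_of_compactSpace _ h1
  convert h2 using 1
  ext x
  simp

lemma differentiable_chebA (a : ℂ) : Differentiable ℂ (chebA a) := by
  unfold chebA cheb; fun_prop

lemma isOpenMap_chebA {a : ℂ} (ha : a ≠ 1) : IsOpenMap (chebA a) := by
  have h1 : AnalyticOnNhd ℂ (chebA a) univ :=
    (differentiable_chebA a).differentiableOn.analyticOnNhd isOpen_univ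
  refine h1.is_constant_or_isOpenMap.resolve_left ?_
  rintro ⟨w, hw⟩
  have h2 : chebA a (affInv a 0) = chebA a (affInv a 1) := by rw [hw, hw]
  rw [chebA_eq, chebA_eq, affA_affInv ha, affA_affInv ha] at h2
  norm_num at h2

lemma sib_eq_aux (a x y : ℂ) : sib a x y = 3 * ((a - 1) * (1 - x) + (a - 1) * (1 - y)) +
    ((a - 1) * (1 - x)) ^ 2 + (a - 1) * (1 - x) * ((a - 1) * (1 - y)) +
      ((a - 1) * (1 - y)) ^ 2 := by
  simp only [sib, affA]; ring

/-- In the coordinate `X = 1 / (1 - z)` two distinct points with the same image satisfy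
`X + Y = (a - 1) / (3 + o(1))` near the cusp, which is incompatible with `Re X, Re Y ≥ 1/2`
when `Re a < 4`. -/
lemma exists_circPt_not_mem {a : ℂ} (ha : a ≠ 1) (h0 : 0 < a.re) (h4 : a.re < 4) :
    ∃ η, ∀ v ∈ Metric.ball (0 : ℂ) 1, sib a (circPt η) v ≠ 0 := by
  by_contra! hcon
  choose v hvb hv using fun n : ℕ => hcon n
  have hx : Tendsto (fun n : ℕ => circPt n) atTop (𝓝 1) := by
    rw [tendsto_iff_norm_sub_tendsto_zero]
    have h1 : Tendsto (fun n : ℕ => (1 : ℝ) / n) atTop (𝓝 0) := tendsto_one_div_atTop_nhds_zero_nat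
    refine squeeze_zero' (Eventually.of_forall fun _ => norm_nonneg _) ?_ h1
    filter_upwards [eventually_gt_atTop 0] with n hn
    have hn' : (0 : ℝ) < n := by exact_mod_cast hn
    rw [show circPt n - 1 = -(1 / (1 / 2 + ((n : ℝ) : ℂ) * Complex.I)) by simp [circPt], norm_neg,
      norm_div, norm_one]
    apply one_div_le_one_div_of_le hn'
    have := Complex.abs_im_le_norm (1 / 2 + ((n : ℝ) : ℂ) * Complex.I)
    simpa using this
  obtain ⟨v', hv', φ, hφ, hlim⟩ := (isCompact_closedBall (0 : ℂ) 1).tendsto_subseq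
    (fun n => Metric.ball_subset_closedBall (hvb n))
  have hx' : Tendsto (fun n => circPt (φ n : ℕ)) atTop (𝓝 1) := hx.comp hφ.tendsto_atTop
  have hs : sib a 1 v' = 0 := by
    have h1 := ((continuous_sib a).tendsto (1, v')).comp (hx'.prodMk_nhds hlim)
    refine tendsto_nhds_unique h1 ?_
    refine tendsto_const_nhds.congr fun n => ?_
    simp only [Function.comp]
    exact (hv (φ n)).symm
  have hv1 : v' = 1 := by
    have hg := chebA_eq_of_sib hs
    rw [chebA_one] at hg
    exact chebA_eq_neg_two_of_norm_le ha h0 (by simpa using hv') hg.symm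
  subst hv1
  -- the limit of the identity `X + Y = (a - 1) / (3 + s + t)`
  have hlim2 : Tendsto (fun n => ((a - 1) / (3 + ((a - 1) * (1 - circPt (φ n : ℕ)) +
      (a - 1) * (1 - v (φ n))))).re) atTop (𝓝 ((a - 1) / 3).re) := by
    apply (Complex.continuous_re.tendsto _).comp
    have hd : Tendsto (fun n => 3 + ((a - 1) * (1 - circPt (φ n : ℕ)) +
      (a - 1) * (1 - v (φ n)))) atTop (𝓝 (3 + ((a - 1) * (1 - 1) + (a - 1) * (1 - 1)))) :=
      tendsto_const_nhds.add ((tendsto_const_nhds.mul (tendsto_const_nhds.sub hx')).add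
        (tendsto_const_nhds.mul (tendsto_const_nhds.sub hlim)))
    have hd' : (3 + ((a - 1) * (1 - 1) + (a - 1) * (1 - 1)) : ℂ) = 3 := by ring
    rw [hd'] at hd
    exact tendsto_const_nhds.div hd (by norm_num)
  have hge : 1 ≤ ((a - 1) / 3).re := by
    refine ge_of_tendsto' hlim2 fun n => ?_
    set x := circPt (φ n : ℕ) with hxdef
    set y := v (φ n) with hydef
    have hyn : ‖y‖ < 1 := by simpa using hvb (φ n)
    have hy1 : y ≠ 1 := by rintro h; rw [h] at hyn; simp at hyn
    have hx1 : x ≠ 1 := circPt_ne_one _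
    have e1 : ((1 - x)⁻¹).re = 1 / 2 := (norm_eq_one_iff_re hx1).1 (norm_circPt _)
    have e2 : 1 / 2 < ((1 - y)⁻¹).re := (norm_lt_one_iff_re hy1).1 hyn
    have hb : a - 1 ≠ 0 := sub_ne_zero.2 ha
    have hx0 : 1 - x ≠ 0 := sub_ne_zero.2 hx1.symm
    have hy0 : 1 - y ≠ 0 := sub_ne_zero.2 hy1.symm
    have hsib : sib a x y = 0 := hv (φ n)
    rw [sib_eq_aux] at hsib
    have hst : ((a - 1) * (1 - x) + (a - 1) * (1 - y)) * (3 + ((a - 1) * (1 - x) +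
        (a - 1) * (1 - y))) = ((a - 1) * (1 - x)) * ((a - 1) * (1 - y)) := by
      linear_combination hsib
    have hd : 3 + ((a - 1) * (1 - x) + (a - 1) * (1 - y)) ≠ 0 := by
      intro h
      rw [h, mul_zero] at hst
      exact mul_ne_zero (mul_ne_zero hb hx0) (mul_ne_zero hb hy0) hst.symm
    have hsum : (a - 1) / (3 + ((a - 1) * (1 - x) + (a - 1) * (1 - y))) =
        (1 - x)⁻¹ + (1 - y)⁻¹ := by
      rw [div_eq_iff hd]
      field_simp
      apply mul_left_cancel₀ hb
      linear_combination -hst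
    rw [hsum, Complex.add_re]
    linarith
  simp at hge
  linarith

section Univalence

variable {a : ℂ}

theorem chebA_sphere_ne_ball (ha : a ≠ 1) (h0 : 0 < a.re) (h4 : a.re < 4)
    (hinj : InjOn (chebA a) (Metric.sphere 0 1)) {x y : ℂ} (hx : ‖x‖ = 1) (hy : ‖y‖ < 1) :
    chebA a x ≠ chebA a y := by
  let A : Set ℝ := {η | chebA a (circPt η) ∈ chebA a '' Metric.ball 0 1}
  have hA : A = {η | ∃ v ∈ Metric.closedBall (0 : ℂ) 1, sib a (circPt η) v = 0} := by
    ext η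
    constructor
    · rintro ⟨v, hv, hve⟩
      refine ⟨v, Metric.ball_subset_closedBall hv, sib_eq_zero ha hve.symm ?_⟩
      rintro rfl
      simp [norm_circPt] at hv
    · rintro ⟨v, hv, hs⟩
      refine ⟨v, ?_, (chebA_eq_of_sib hs).symm⟩
      by_contra hv'
      have hv1 : ‖v‖ = 1 := le_antisymm (by simpa using hv) (by simpa using hv')
      have hve : circPt η = v := hinj (by simpa using norm_circPt η) (by simpa using hv1)
        (chebA_eq_of_sib hs)
      rw [← hve] at hs
      exact circPt_ne_one η (sib_self_of_norm_le ha h0 (norm_circPt η).le hs)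
  have hopen : IsOpen A := ((isOpenMap_chebA ha) _ Metric.isOpen_ball).preimage (by fun_prop)
  have hclosed : IsClosed A := by
    rw [hA]
    exact isClosed_setOf_exists_zero (isCompact_closedBall 0 1)
      ((continuous_sib a).comp (f := fun p : ℝ × ℂ => (circPt p.1, p.2)) (by fun_prop))
  have hempty : A = ∅ := by
    refine (isClopen_iff.1 ⟨hclosed, hopen⟩).resolve_right ?_
    intro huniv
    obtain ⟨η, hη⟩ := exists_circPt_not_mem ha h0 h4
    obtain ⟨v, hv, hve⟩ : η ∈ A := huniv ▸ mem_univ η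
    refine hη v hv (sib_eq_zero ha hve.symm ?_)
    rintro rfl
    simp [norm_circPt] at hv
  intro hxy
  by_cases h1 : x = 1
  · subst h1
    rw [chebA_one] at hxy
    rw [chebA_eq_neg_two_of_norm_le ha h0 hy.le hxy.symm] at hy
    simp at hy
  · obtain ⟨η, rfl⟩ := exists_circPt hx h1
    have : η ∈ A := ⟨y, by simpa using hy, hxy.symm⟩
    rw [hempty] at this
    exact this

/-- The boundary values determine the degree: `f_a` is univalent on the closed disk. The set of
points of the disk with a partner in the disk is clopen, and cannot be everything, because a
partner of a boundary point would be a boundary point. -/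
theorem injOn_closedBall (ha : a ≠ 1) (h0 : 0 < a.re) (h4 : a.re < 4)
    (hinj : InjOn (chebA a) (Metric.sphere 0 1)) :
    InjOn (chebA a) (Metric.closedBall 0 1) := by
  have hdis := fun {x y : ℂ} => chebA_sphere_ne_ball (x := x) (y := y) ha h0 h4 hinj
  let B : Set ℂ := {u | ∃ v ∈ Metric.closedBall (0 : ℂ) 1, sib a u v = 0}
  have hB : IsClosed B := isClosed_setOf_exists_zero (isCompact_closedBall 0 1) (continuous_sib a)
  let A : Set ℂ := {u | u ∈ Metric.ball 0 1 ∧ ∃ v ∈ Metric.ball (0 : ℂ) 1, sib a u v = 0}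
  have hAB : ∀ u ∈ Metric.ball (0 : ℂ) 1, u ∈ B → u ∈ A := by
    rintro u hu ⟨v, hv, hs⟩
    refine ⟨hu, v, ?_, hs⟩
    by_contra hv'
    have hv1 : ‖v‖ = 1 := le_antisymm (by simpa using hv) (by simpa using hv')
    exact hdis hv1 (by simpa using hu) (chebA_eq_of_sib hs).symm
  have hAo : IsOpen A := by
    rw [isOpen_iff_mem_nhds]
    rintro u ⟨hu, v, hv, hs⟩
    have huv : u ≠ v := by
      rintro rfl
      have h1 := sib_self_of_norm_le ha h0
        (by simpa using Metric.ball_subset_closedBall hu) hs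
      rw [h1] at hu
      simp at hu
    obtain ⟨U, V, hU, hV, huU, hvV, hUV⟩ := t2_separation huv
    have hVo : IsOpen (chebA a '' (V ∩ Metric.ball 0 1)) :=
      isOpenMap_chebA ha _ (hV.inter Metric.isOpen_ball)
    have h1 : ∀ᶠ u' in 𝓝 u, chebA a u' ∈ chebA a '' (V ∩ Metric.ball 0 1) :=
      (continuous_chebA a).continuousAt.eventually
        (hVo.mem_nhds ⟨v, ⟨hvV, hv⟩, (chebA_eq_of_sib hs).symm⟩)
    filter_upwards [h1, hU.mem_nhds huU, Metric.isOpen_ball.mem_nhds hu] with u' h2 h3 h4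
    obtain ⟨v', ⟨hv1, hv2⟩, hv3⟩ := h2
    refine ⟨h4, v', hv2, sib_eq_zero ha hv3.symm ?_⟩
    rintro rfl
    exact disjoint_left.1 hUV h3 hv1
  have hAe : ∀ u ∈ Metric.ball (0 : ℂ) 1, u ∉ A := by
    intro u hu huA
    have hpre : IsPreconnected (Metric.ball (0 : ℂ) 1) := (convex_ball 0 1).isPreconnected
    have hsub : Metric.ball (0 : ℂ) 1 ⊆ A := by
      refine hpre.subset_left_of_subset_union hAo hB.isOpen_compl ?_ ?_ ⟨u, hu, huA⟩
      · rw [disjoint_left]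
        rintro x ⟨-, v, hv, hs⟩ hx
        exact hx ⟨v, Metric.ball_subset_closedBall hv, hs⟩
      · intro x hx
        by_cases h : x ∈ B
        · exact Or.inl (hAB x hx h)
        · exact Or.inr h
    have hcl : Metric.closedBall (0 : ℂ) 1 ⊆ B := by
      rw [← closure_ball (0 : ℂ) one_ne_zero]
      refine closure_minimal (fun x hx => ?_) hB
      obtain ⟨-, v, hv, hs⟩ := hsub hx
      exact ⟨v, Metric.ball_subset_closedBall hv, hs⟩
    obtain ⟨v, hv, hs⟩ := hcl (show (-1 : ℂ) ∈ _ by simp)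
    have hv1 : ‖v‖ = 1 := by
      by_contra hne
      exact hdis (x := -1) (by simp) (lt_of_le_of_ne (by simpa using hv) hne) (chebA_eq_of_sib hs)
    have hve : (-1 : ℂ) = v := hinj (by simp) (by simpa using hv1) (chebA_eq_of_sib hs)
    rw [← hve] at hs
    have := sib_self_of_norm_le ha h0 (by simp) hs
    norm_num at this
  intro x hx y hy hxy
  have hx' : ‖x‖ ≤ 1 := by simpa using hx
  have hy' : ‖y‖ ≤ 1 := by simpa using hy
  rcases hx'.lt_or_eq with h1 | h1 <;> rcases hy'.lt_or_eq with h2 | h2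
  · by_contra hne
    exact hAe x (by simpa using h1) ⟨by simpa using h1, y, by simpa using h2,
      sib_eq_zero ha hxy hne⟩
  · exact absurd hxy.symm (hdis h2 h1)
  · exact absurd hxy (hdis h1 h2)
  · exact hinj (by simpa using h1) (by simpa using h2) hxy

end Univalence

/-! ### Escape levels in the plane -/

/-- The consequences of `a ∈ S` used below: `f_a` is injective on the closed unit disk, and the
critical value `2` lies in `Ω_a`. -/
structure IsUnivalentParam (a : ℂ) : Prop where
  ne_one : a ≠ 1
  re_gt : 3 / 2 < a.re
  injOn : InjOn (chebA a) (Metric.closedBall 0 1)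

lemma isUnivalentParam_of_mem {a : ℂ} (h : a ∈ paramS) : IsUnivalentParam a :=
  ⟨h.1.2.1, h.2.1, injOn_closedBall h.1.2.1 h.1.1 h.2.2 (injOn_sphere h.1.2.1 h.1.1 h.1.2.2)⟩

/-- The finite part of `σ_a^{-n}(T_a⁰) ∪ ⋯ ∪ T_a⁰`, described through `f_a` and the reflection
in the unit circle. -/
def escSet (a : ℂ) : ℕ → Set ℂ
  | 0 => {w | w ∉ domainΩ a ∧ w ≠ -2}
  | n + 1 => {w | w ∉ domainΩ a ∧ w ≠ -2} ∪
      {w | ∃ z : ℂ, ‖z‖ ≤ 1 ∧ chebA a z = w ∧ (z ≠ 0 → chebA a (conj z)⁻¹ ∈ escSet a n)}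

lemma norm_conj_inv (z : ℂ) : ‖(conj z)⁻¹‖ = ‖z‖⁻¹ := by simp

lemma conj_inv_conj_inv (z : ℂ) : (conj (conj z)⁻¹)⁻¹ = z := by simp

lemma conj_inv_of_norm_one {z : ℂ} (h : ‖z‖ = 1) : (conj z)⁻¹ = z := by
  rw [Complex.inv_def, Complex.conj_conj, Complex.normSq_conj, Complex.normSq_eq_norm_sq, h]; simp

lemma escSet_zero_subset (a : ℂ) (n : ℕ) : escSet a 0 ⊆ escSet a n := by
  cases n with
  | zero => exact subset_rfl
  | succ n => exact subset_union_left

lemma escSet_subset_succ (a : ℂ) (n : ℕ) : escSet a n ⊆ escSet a (n + 1) := by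
  induction n with
  | zero => exact subset_union_left
  | succ n ih =>
    rintro w (hw | ⟨z, hz, rfl, h⟩)
    · exact Or.inl hw
    · exact Or.inr ⟨z, hz, rfl, fun h0 => ih (h h0)⟩

lemma escSet_mono (a : ℂ) : Monotone (escSet a) := monotone_nat_of_le_succ (escSet_subset_succ a)

namespace IsUnivalentParam

variable {a : ℂ} (H : IsUnivalentParam a)
include H

lemma re_pos : 0 < a.re := by linarith [H.re_gt]

lemma mem_domainΩ_iff {z : ℂ} (hz : ‖z‖ ≤ 1) : chebA a z ∈ domainΩ a ↔ ‖z‖ < 1 := by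
  rw [domainΩ_eq H.ne_one]
  constructor
  · rintro ⟨x, hx, hxz⟩
    rw [← H.injOn (Metric.ball_subset_closedBall hx) (by simpa using hz) hxz]
    simpa using hx
  · intro h
    exact ⟨z, by simpa using h, rfl⟩

lemma exists_of_mem_domainΩ {w : ℂ} (hw : w ∈ domainΩ a) : ∃ z, ‖z‖ < 1 ∧ chebA a z = w := by
  rw [domainΩ_eq H.ne_one] at hw
  obtain ⟨z, hz, rfl⟩ := hw
  exact ⟨z, by simpa using hz, rfl⟩

lemma eq_of_chebA_eq {x y : ℂ} (hx : ‖x‖ ≤ 1) (hy : ‖y‖ ≤ 1) (h : chebA a x = chebA a y) :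
    x = y := H.injOn (by simpa using hx) (by simpa using hy) h

lemma isOpen_domainΩ : IsOpen (domainΩ a) := by
  rw [domainΩ_eq H.ne_one]
  exact isOpenMap_chebA H.ne_one _ Metric.isOpen_ball

lemma closure_domainΩ : closure (domainΩ a) = chebA a '' Metric.closedBall 0 1 := by
  rw [domainΩ_eq H.ne_one, ← closure_ball (0 : ℂ) one_ne_zero]
  refine (image_closure_of_isCompact ?_ (continuous_chebA a).continuousOn).symm
  rw [closure_ball (0 : ℂ) one_ne_zero]
  exact isCompact_closedBall 0 1

lemma chebA_mem_escSet_zero_iff {z : ℂ} (hz : ‖z‖ ≤ 1) :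
    chebA a z ∈ escSet a 0 ↔ ‖z‖ = 1 ∧ z ≠ 1 := by
  simp only [escSet, mem_ofPred_eq, H.mem_domainΩ_iff hz, not_lt]
  constructor
  · rintro ⟨h1, h2⟩
    refine ⟨le_antisymm hz h1, ?_⟩
    rintro rfl
    exact h2 (chebA_one a)
  · rintro ⟨h1, h2⟩
    exact ⟨h1.ge, fun h => h2 (chebA_eq_neg_two_of_norm_le H.ne_one H.re_pos hz h)⟩

lemma neg_two_not_mem_escSet (n : ℕ) : (-2 : ℂ) ∉ escSet a n := by
  induction n with
  | zero => exact fun h => h.2 rfl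
  | succ n ih =>
    rintro (h | ⟨z, hz, hz2, h⟩)
    · exact h.2 rfl
    · have h1 := chebA_eq_neg_two_of_norm_le H.ne_one H.re_pos hz hz2
      subst h1
      have := h one_ne_zero
      simp only [map_one, inv_one, chebA_one] at this
      exact ih this

omit H in
lemma chebA_zero_mem (n : ℕ) : chebA a 0 ∈ escSet a (n + 1) :=
  Or.inr ⟨0, by simp, rfl, fun h => absurd rfl h⟩

/-- The dynamical description of the escape levels: `σ_a(f_a(z)) = f_a(ι(z))` on the closed
disk. -/
lemma chebA_mem_succ_iff {z : ℂ} (hz : ‖z‖ ≤ 1) (hz0 : z ≠ 0) (n : ℕ) :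
    chebA a z ∈ escSet a (n + 1) ↔ chebA a (conj z)⁻¹ ∈ escSet a n := by
  constructor
  · rintro (h | ⟨x, hx, hxz, h⟩)
    · have h1 := (H.chebA_mem_escSet_zero_iff hz).1 h
      rw [conj_inv_of_norm_one h1.1]
      exact escSet_zero_subset a n h
    · have h1 := H.eq_of_chebA_eq hx hz hxz
      subst h1
      exact h hz0
  · intro h
    exact Or.inr ⟨z, hz, rfl, fun _ => h⟩

end IsUnivalentParam

/-! ### Connectedness of the escape levels -/

/-- If the boundary of an open set relative to a connected set `M` is connected, then so is the
complement of the open set in `M`. -/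
lemma isPreconnected_diff {M V : Set ℂ} (hM : IsPreconnected M) (hV : IsOpen V)
    (hF : IsPreconnected (M ∩ (closure V \ V))) : IsPreconnected (M \ V) := by
  rw [isPreconnected_iff_subset_of_disjoint_closed]
  intro u v hu hv huv hdis
  have key : ∀ u v : Set ℂ, IsClosed u → IsClosed v → M \ V ⊆ u ∪ v → M \ V ∩ (u ∩ v) = ∅ →
      M ∩ (closure V \ V) ⊆ u → M \ V ⊆ u ∨ M \ V ⊆ v := by
    intro u v hu hv huv hdis hFu
    have h1 := isPreconnected_iff_subset_of_disjoint_closed.1 hM (u ∪ closure V) (v \ V)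
      (hu.union isClosed_closure) (hv.sdiff hV) ?_ ?_
    · rcases h1 with h1 | h1
      · left
        rintro x ⟨hx, hxV⟩
        rcases h1 hx with h2 | h2
        · exact h2
        · exact hFu ⟨hx, h2, hxV⟩
      · right
        rintro x ⟨hx, hxV⟩
        exact (h1 hx).1
    · intro x hx
      by_cases hxV : x ∈ V
      · exact Or.inl (Or.inr (subset_closure hxV))
      · rcases huv ⟨hx, hxV⟩ with h2 | h2
        · exact Or.inl (Or.inl h2)
        · exact Or.inr ⟨h2, hxV⟩
    · rw [eq_empty_iff_forall_notMem] at hdis ⊢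
      rintro x ⟨hx, h2, h3, h4⟩
      have h5 : x ∈ u := h2.elim id fun h => hFu ⟨hx, h, h4⟩
      exact hdis x ⟨⟨hx, h4⟩, h5, h3⟩
  have hsub : M ∩ (closure V \ V) ⊆ M \ V := fun x hx => ⟨hx.1, hx.2.2⟩
  have h1 := isPreconnected_iff_subset_of_disjoint_closed.1 hF u v hu hv (hsub.trans huv) (by
    rw [← subset_empty_iff, ← hdis]
    exact inter_subset_inter_left _ hsub)
  rcases h1 with h1 | h1
  · exact key u v hu hv huv hdis h1
  · exact (key v u hv hu (union_comm u v ▸ huv) (inter_comm u v ▸ hdis) h1).symm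

/-- The preimage of a connected set under an open and closed map is connected as soon as some
fiber is contained in a connected part of it. -/
lemma isPreconnected_preimage_of_fiber {g : ℂ → ℂ} (hgo : IsOpenMap g) (hgc : IsClosedMap g)
    {S V : Set ℂ} (hS : IsPreconnected S) (hV : IsPreconnected V) (hVS : V ⊆ g ⁻¹' S) {w : ℂ}
    (hwS : w ∈ S) (hw : g ⁻¹' {w} ⊆ V) : IsPreconnected (g ⁻¹' S) := by
  rw [isPreconnected_iff_subset_of_disjoint_closed]
  intro u v hu hv huv hdis
  -- a relatively clopen part of the preimage is empty or meets every fiber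
  have key : ∀ u v : Set ℂ, IsClosed u → IsClosed v → g ⁻¹' S ⊆ u ∪ v →
      g ⁻¹' S ∩ (u ∩ v) = ∅ → g ⁻¹' S ⊆ v ∨ ∃ x ∈ V, x ∈ u := by
    intro u v hu hv huv hdis
    have h1 := isPreconnected_iff_subset_of_disjoint_closed.1 hS (g '' u) (g '' vᶜ)ᶜ
      (hgc _ hu) (hgo _ hv.isOpen_compl).isClosed_compl ?_ ?_
    · rcases h1 with h1 | h1
      · right
        obtain ⟨x, hx, hxw⟩ := h1 hwS
        exact ⟨x, hw hxw, hx⟩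
      · left
        intro x hx
        by_contra hxv
        exact h1 hx ⟨x, hxv, rfl⟩
    · intro y hy
      by_cases h : y ∈ g '' vᶜ
      · obtain ⟨x, hx, rfl⟩ := h
        exact Or.inl ⟨x, (huv hy).resolve_right hx, rfl⟩
      · exact Or.inr h
    · rw [eq_empty_iff_forall_notMem] at hdis ⊢
      rintro y ⟨hy, ⟨x, hx, rfl⟩, h⟩
      exact hdis x ⟨hy, hx, by_contra fun hxv => h ⟨x, hxv, rfl⟩⟩
  rcases key u v hu hv huv hdis with h1 | ⟨x, hx, hxu⟩
  · exact Or.inr h1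
  rcases key v u hv hu (union_comm u v ▸ huv) (inter_comm u v ▸ hdis) with h1 | ⟨y, hy, hyv⟩
  · exact Or.inl h1
  exfalso
  obtain ⟨t, ht, ht'⟩ := isPreconnected_closed_iff.1 hV u v hu hv (hVS.trans huv) ⟨x, hx, hxu⟩
    ⟨y, hy, hyv⟩
  exact eq_empty_iff_forall_notMem.1 hdis t ⟨hVS ht, ht'⟩

lemma isPreconnected_norm_gt {R : ℝ} (hR : 0 ≤ R) : IsPreconnected {z : ℂ | R < ‖z‖} := by
  have h1 : IsPreconnected ((Ioi R) ×ˢ (univ : Set ℝ)) :=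
    isPreconnected_Ioi.prod isPreconnected_univ
  have h2 := h1.image (fun p : ℝ × ℝ => (p.1 : ℂ) * Complex.exp (p.2 * Complex.I))
    (by fun_prop)
  convert h2 using 1
  ext z
  constructor
  · intro hz
    exact ⟨(‖z‖, z.arg), ⟨hz, mem_univ _⟩, Complex.norm_mul_exp_arg_mul_I z⟩
  · rintro ⟨⟨r, t⟩, ⟨hr, -⟩, rfl⟩
    have hr' : R < r := hr
    simp [Complex.norm_exp_ofReal_mul_I, abs_of_pos (hR.trans_lt hr'), hr']

/-- `f_a` as a polynomial. -/
noncomputable def chebPoly (a : ℂ) : Polynomial ℂ :=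
  (Polynomial.C (1 - a) * Polynomial.X + Polynomial.C a) ^ 3 -
    3 * (Polynomial.C (1 - a) * Polynomial.X + Polynomial.C a)

lemma eval_chebPoly (a : ℂ) : (fun z => (chebPoly a).eval z) = chebA a := by
  ext z
  simp [chebPoly, chebA, cheb]; ring

lemma isClosedMap_chebA (a : ℂ) : IsClosedMap (chebA a) :=
  eval_chebPoly a ▸ (chebPoly a).isClosedMap_eval

lemma tendsto_norm_chebA {a : ℂ} (ha : a ≠ 1) :
    Tendsto (fun z => ‖chebA a z‖) (cocompact ℂ) atTop := by
  have hdeg : (chebPoly a).natDegree = 3 := by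
    have h1 : ¬1 - a = 0 := sub_ne_zero.2 ha.symm
    unfold chebPoly
    compute_degree!
  have h1 := (chebPoly a).tendsto_norm_atTop (Polynomial.natDegree_pos_iff_degree_pos.1
    (by rw [hdeg]; norm_num)) (z := fun z : ℂ => z) (l := cocompact ℂ)
    (tendsto_norm_cocompact_atTop)
  simpa only [← eval_chebPoly a] using h1

/-- The retraction of the plane onto the closed disk by reflection in the unit circle. -/
noncomputable def fold (z : ℂ) : ℂ := z / (max 1 (‖z‖ ^ 2) : ℝ)

lemma fold_denom_ne (z : ℂ) : ((max 1 (‖z‖ ^ 2) : ℝ) : ℂ) ≠ 0 := by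
  have : (0 : ℝ) < max 1 (‖z‖ ^ 2) := lt_max_of_lt_left one_pos
  exact_mod_cast this.ne'

lemma continuous_fold : Continuous fold := by
  unfold fold
  exact continuous_id.div (by fun_prop) fold_denom_ne

lemma fold_of_norm_le {z : ℂ} (h : ‖z‖ ≤ 1) : fold z = z := by
  rw [fold, max_eq_left (pow_le_one₀ (norm_nonneg z) h)]; simp

lemma fold_of_one_le {z : ℂ} (h : 1 ≤ ‖z‖) : fold z = (conj z)⁻¹ := by
  rw [fold, max_eq_right (one_le_pow₀ h), Complex.inv_def, Complex.conj_conj, Complex.normSq_conj,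
    Complex.normSq_eq_norm_sq, div_eq_mul_inv]
  simp

namespace IsUnivalentParam

variable {a : ℂ} (H : IsUnivalentParam a)
include H

lemma exists_radius : ∃ R : ℝ, 1 ≤ R ∧ ∀ z : ℂ, R < ‖z‖ → chebA a z ∈ escSet a 0 := by
  have h1 : Bornology.IsBounded (chebA a '' Metric.closedBall 0 1) :=
    ((isCompact_closedBall (0 : ℂ) 1).image (continuous_chebA a)).isBounded
  obtain ⟨C, hC⟩ := h1.exists_norm_le
  have h2 := (tendsto_norm_chebA H.ne_one).eventually_gt_atTop C
  rw [← Metric.cobounded_eq_cocompact, ← comap_norm_atTop, eventually_comap] at h2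
  obtain ⟨R, hR⟩ := eventually_atTop.1 h2
  refine ⟨max 1 R, le_max_left _ _, fun z hz => ?_⟩
  have h3 := hR ‖z‖ ((le_max_right _ _).trans hz.le) z rfl
  refine ⟨fun h => ?_, fun h => ?_⟩
  · obtain ⟨x, hx, hxz⟩ := H.exists_of_mem_domainΩ h
    exact absurd (hC _ ⟨x, by simpa using hx.le, hxz⟩) (not_le.2 h3)
  · refine absurd (hC _ ⟨1, by simp, chebA_one a⟩) (not_le.2 ?_)
    rw [← h]; exact h3

lemma isPreconnected_escSet_zero : IsPreconnected (escSet a 0) := by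
  have h1 : escSet a 0 = {(-2 : ℂ)}ᶜ \ domainΩ a := by
    ext w; simp [escSet, and_comm]
  rw [h1]
  refine isPreconnected_diff (isConnected_compl_singleton_of_one_lt_rank (by simp) _).isPreconnected
    H.isOpen_domainΩ ?_
  have h2 : {(-2 : ℂ)}ᶜ ∩ (closure (domainΩ a) \ domainΩ a) =
      range fun η => chebA a (circPt η) := by
    rw [H.closure_domainΩ]
    ext w
    constructor
    · rintro ⟨hw, ⟨z, hz, rfl⟩, hw'⟩
      have hz' : ‖z‖ ≤ 1 := by simpa using hz
      rw [H.mem_domainΩ_iff hz', not_lt] at hw'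
      obtain ⟨η, rfl⟩ := exists_circPt (le_antisymm hz' hw') (by
        rintro rfl
        exact hw (chebA_one a))
      exact ⟨η, rfl⟩
    · rintro ⟨η, rfl⟩
      refine ⟨fun h => circPt_ne_one η (chebA_eq_neg_two_of_norm_le H.ne_one H.re_pos
        (norm_circPt η).le h), ⟨circPt η, by simp [norm_circPt], rfl⟩, ?_⟩
      change chebA a (circPt η) ∉ domainΩ a
      rw [H.mem_domainΩ_iff (norm_circPt η).le]
      simp [norm_circPt]
  rw [h2]
  exact isPreconnected_range (by fun_prop)

lemma isPreconnected_preimage {S : Set ℂ} (hS : IsPreconnected S) (h0 : escSet a 0 ⊆ S) :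
    IsPreconnected (chebA a ⁻¹' S) := by
  obtain ⟨R, hR1, hR⟩ := H.exists_radius
  obtain ⟨C, hC⟩ :=
    ((isCompact_closedBall (0 : ℂ) R).image (continuous_chebA a)).isBounded.exists_norm_le
  obtain ⟨z, hz1, hz2⟩ : ∃ z : ℂ, C < ‖chebA a z‖ ∧ R < ‖z‖ :=
    (((tendsto_norm_chebA H.ne_one).eventually_gt_atTop C).and
      ((tendsto_norm_cocompact_atTop (E := ℂ)).eventually_gt_atTop R)).exists
  refine isPreconnected_preimage_of_fiber (isOpenMap_chebA H.ne_one) (isClosedMap_chebA a) hS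
    (isPreconnected_norm_gt (by linarith : 0 ≤ R)) (fun x hx => h0 (hR x hx))
    (h0 (hR z hz2)) ?_
  intro x hx
  by_contra hxR
  have h1 := hC _ ⟨x, by simpa using hxR, rfl⟩
  rw [show chebA a x = chebA a z from hx] at h1
  exact absurd h1 (not_le.2 hz1)

omit H in
lemma escSet_succ_eq (n : ℕ) : escSet a (n + 1) = escSet a 0 ∪
    insert (chebA a 0) ((fun z => chebA a (fold z)) '' (chebA a ⁻¹' escSet a n)) := by
  apply Subset.antisymm
  · rintro w (h | ⟨z, hz, rfl, h⟩)
    · exact Or.inl h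
    · right
      by_cases hz0 : z = 0
      · rw [hz0]; exact mem_insert _ _
      · refine mem_insert_of_mem _ ⟨(conj z)⁻¹, h hz0, ?_⟩
        have h1 : 1 ≤ ‖(conj z)⁻¹‖ := by
          rw [norm_conj_inv]
          exact (one_le_inv₀ (norm_pos_iff.2 hz0)).2 hz
        simp only [fold_of_one_le h1, conj_inv_conj_inv]
  · rintro w (h | rfl | ⟨z, hz, rfl⟩)
    · exact Or.inl h
    · exact chebA_zero_mem n
    · simp only
      rcases le_or_gt ‖z‖ 1 with h1 | h1
      · rw [fold_of_norm_le h1]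
        exact escSet_subset_succ a n hz
      · rw [fold_of_one_le h1.le]
        refine Or.inr ⟨_, ?_, rfl, fun _ => ?_⟩
        · rw [norm_conj_inv]; exact inv_le_one_of_one_le₀ h1.le
        · rw [conj_inv_conj_inv]; exact hz

lemma neg_one_mem : chebA a (-1) ∈ escSet a 0 :=
  (H.chebA_mem_escSet_zero_iff (by simp)).2 ⟨by simp, by norm_num⟩

/-- The escape levels are connected: level `n + 1` is the union of `T_a⁰` and of the image under
`f_a` of the preimage of level `n`, folded into the disk. -/
theorem isPreconnected_escSet (n : ℕ) : IsPreconnected (escSet a n) := by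
  induction n with
  | zero => exact H.isPreconnected_escSet_zero
  | succ n ih =>
    have hW := H.isPreconnected_preimage ih (escSet_zero_subset a n)
    have hI := hW.image (fun z => chebA a (fold z))
      ((continuous_chebA a).comp continuous_fold).continuousOn
    have hI' : IsPreconnected (insert (chebA a 0)
        ((fun z => chebA a (fold z)) '' (chebA a ⁻¹' escSet a n))) := by
      refine hI.subset_closure (subset_insert _ _) (insert_subset ?_ subset_closure)
      obtain ⟨R, hR1, hR⟩ := H.exists_radius
      have h1 : Tendsto (fun r : ℝ => fold r) atTop (𝓝 0) := by
        rw [tendsto_zero_iff_norm_tendsto_zero]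
        refine tendsto_inv_atTop_zero.congr' ?_
        filter_upwards [eventually_ge_atTop 1] with r hr
        have h2 : ‖(r : ℂ)‖ = r := by simp; linarith
        rw [fold_of_one_le (by rw [h2]; exact hr), norm_conj_inv, h2]
      have h2 : Tendsto (fun r : ℝ => chebA a (fold r)) atTop (𝓝 (chebA a 0)) :=
        ((continuous_chebA a).tendsto 0).comp h1
      refine mem_closure_of_tendsto h2 ?_
      filter_upwards [eventually_gt_atTop R] with r hr
      refine ⟨r, escSet_zero_subset a n (hR _ ?_), rfl⟩
      have h2 : ‖(r : ℂ)‖ = r := by simp; linarith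
      rw [h2]; exact hr
    rw [escSet_succ_eq n]
    refine IsPreconnected.union (chebA a (-1)) H.neg_one_mem ?_ H.isPreconnected_escSet_zero hI'
    refine mem_insert_of_mem _ ⟨-1, escSet_zero_subset a n H.neg_one_mem, ?_⟩
    simp only
    rw [fold_of_norm_le (by simp)]

/-! ### Each escape level is in the interior of the next one -/

lemma escSet_zero_subset_interior : escSet a 0 ⊆ interior (escSet a 1) := by
  intro w hw
  -- the points of `Ω_a` for which the reflected point has a partner in the closed disk
  let B : Set ℂ := (fun y => chebA a (fold y)) '' (Metric.closedBall 0 2 ∩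
    ({y | 1 ≤ ‖y‖} ∩ {y | ∃ x ∈ Metric.closedBall (0 : ℂ) 1, sib a y x = 0}))
  have hB : IsClosed B := by
    refine IsCompact.isClosed (IsCompact.image ?_ ((continuous_chebA a).comp continuous_fold))
    exact (isCompact_closedBall 0 2).inter_right
      ((isClosed_le continuous_const continuous_norm).inter
        (isClosed_setOf_exists_zero (isCompact_closedBall 0 1) (continuous_sib a)))
  have hC : IsClosed (chebA a '' Metric.closedBall 0 (1 / 2)) :=
    isClosedMap_chebA a _ Metric.isClosed_closedBall
  have hwB : w ∉ B := by
    rintro ⟨y, ⟨-, hy1, x, hx, hs⟩, rfl⟩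
    have hy1' : 1 ≤ ‖y‖ := hy1
    have hx' : ‖x‖ ≤ 1 := by simpa using hx
    simp only [fold_of_one_le hy1'] at hw
    have h1 := (H.chebA_mem_escSet_zero_iff (by
      rw [norm_conj_inv]; exact inv_le_one_of_one_le₀ hy1')).1 hw
    have h2 : ‖y‖ = 1 := by rw [norm_conj_inv] at h1; exact inv_eq_one.1 h1.1
    rw [conj_inv_of_norm_one h2] at h1
    have h3 := H.eq_of_chebA_eq h2.le hx' (chebA_eq_of_sib hs)
    rw [← h3] at hs
    exact h1.2 (sib_self_of_norm_le H.ne_one H.re_pos h2.le hs)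
  have hwC : w ∉ chebA a '' Metric.closedBall 0 (1 / 2) := by
    rintro ⟨z, hz, rfl⟩
    have hz' : ‖z‖ ≤ 1 / 2 := by simpa using hz
    have h1 := (H.chebA_mem_escSet_zero_iff (by linarith)).1 hw
    rw [h1.1] at hz'
    norm_num at hz'
  rw [mem_interior_iff_mem_nhds]
  filter_upwards [hB.isOpen_compl.mem_nhds hwB, hC.isOpen_compl.mem_nhds hwC,
    isOpen_ne.mem_nhds hw.2] with v hvB hvC hv2
  by_cases hv : v ∈ domainΩ a
  swap
  · exact escSet_zero_subset a 1 ⟨hv, hv2⟩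
  obtain ⟨z, hz, rfl⟩ := H.exists_of_mem_domainΩ hv
  have hz2 : 1 / 2 < ‖z‖ := by
    by_contra h
    exact hvC ⟨z, by simpa using h, rfl⟩
  have hz0 : 0 < ‖z‖ := by linarith
  have hy1 : 1 < ‖(conj z)⁻¹‖ := by
    rw [norm_conj_inv]; exact (one_lt_inv₀ hz0).2 hz
  have hy2 : ‖(conj z)⁻¹‖ ≤ 2 := by
    rw [norm_conj_inv]; exact inv_le_of_inv_le₀ (by norm_num) (by linarith)
  have hmem : ∀ x : ℂ, ‖x‖ ≤ 1 → chebA a x ≠ chebA a (conj z)⁻¹ := by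
    intro x hx hxy
    refine hvB ⟨(conj z)⁻¹, ⟨by simpa using hy2, hy1.le, x, by simpa using hx,
      sib_eq_zero H.ne_one hxy.symm ?_⟩, ?_⟩
    · rintro rfl
      linarith
    · simp only [fold_of_one_le hy1.le, conj_inv_conj_inv]
  refine Or.inr ⟨z, hz.le, rfl, fun _ => ⟨fun h => ?_, fun h => ?_⟩⟩
  · obtain ⟨x, hx, hxy⟩ := H.exists_of_mem_domainΩ h
    exact hmem x hx.le hxy
  · exact hmem 1 (by simp) ((chebA_one a).trans h.symm)

theorem escSet_subset_interior (n : ℕ) : escSet a n ⊆ interior (escSet a (n + 1)) := by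
  induction n with
  | zero => exact H.escSet_zero_subset_interior
  | succ n ih =>
    have hbase : escSet a 0 ⊆ interior (escSet a (n + 2)) :=
      H.escSet_zero_subset_interior.trans (interior_mono (escSet_mono a (by omega)))
    rintro w (hw | ⟨z, hz, rfl, h⟩)
    · exact hbase hw
    rcases hz.lt_or_eq with hz1 | hz1
    swap
    · refine hbase ((H.chebA_mem_escSet_zero_iff hz).2 ⟨hz1, ?_⟩)
      rintro rfl
      have := h one_ne_zero
      simp only [map_one, inv_one, chebA_one] at this
      exact H.neg_two_not_mem_escSet n this
    have hnear : ∀ᶠ x in 𝓝 z, ‖x‖ < 1 := (isOpen_lt continuous_norm continuous_const).mem_nhds hz1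
    have hnear2 : ∀ᶠ x in 𝓝 z, x ≠ 0 → chebA a (conj x)⁻¹ ∈ escSet a (n + 1) := by
      by_cases hz0 : z = 0
      · subst hz0
        obtain ⟨R, hR1, hR⟩ := H.exists_radius
        have hR0 : 0 < R := by linarith
        filter_upwards [Metric.ball_mem_nhds (0 : ℂ) (inv_pos.2 hR0)] with x hx hx0
        refine escSet_zero_subset a _ (hR _ ?_)
        rw [norm_conj_inv]
        exact (lt_inv_comm₀ hR0 (norm_pos_iff.2 hx0)).2 (by simpa using hx)
      · have h1 : ContinuousAt (fun x : ℂ => chebA a (conj x)⁻¹) z := by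
          refine (continuous_chebA a).continuousAt.comp ?_
          exact Complex.continuous_conj.continuousAt.inv₀ (by simpa using hz0)
        have h2 := h1.eventually (isOpen_interior.mem_nhds (ih (h hz0)))
        filter_upwards [h2] with x hx _
        exact interior_subset hx
    rw [mem_interior_iff_mem_nhds]
    refine mem_of_superset ((isOpenMap_chebA H.ne_one).image_mem_nhds (hnear.and hnear2)) ?_
    rintro _ ⟨x, ⟨h1, h2⟩, rfl⟩
    exact Or.inr ⟨x, h1.le, rfl, h2⟩

end IsUnivalentParam

/-! ### The finite part of the tiling set -/

/-- The finite part of the tiling set. -/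
def finTiling (a : ℂ) : Set ℂ := ⋃ n, escSet a n

lemma infty_mem_droplet (a : ℂ) : (OnePoint.infty : Sphere) ∈ droplet a := by
  refine ⟨?_, OnePoint.infty_ne_coe _⟩
  rintro ⟨w, -, hw⟩
  exact OnePoint.coe_ne_infty w hw

lemma coe_mem_droplet {a w : ℂ} : (w : Sphere) ∈ droplet a ↔ w ∈ escSet a 0 := by
  simp [droplet, escSet]

lemma reflect_coe {z : ℂ} (hz : z ≠ 0) : reflect (z : Sphere) = (((conj z)⁻¹ : ℂ) : Sphere) :=
  if_neg hz

lemma reflect_zero : reflect ((0 : ℂ) : Sphere) = OnePoint.infty := if_pos rfl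

lemma reflect_infty : reflect OnePoint.infty = ((0 : ℂ) : Sphere) := rfl

lemma chebSphere_coe (a z : ℂ) : chebSphere a (z : Sphere) = (chebA a z : Sphere) := rfl

lemma chebSphere_infty (a : ℂ) : chebSphere a OnePoint.infty = OnePoint.infty := rfl

namespace IsUnivalentParam

variable {a : ℂ} (H : IsUnivalentParam a)
include H

lemma schwarz_chebA {z : ℂ} (hz : ‖z‖ ≤ 1) :
    schwarz a (chebA a z) = chebSphere a (reflect (z : Sphere)) := by
  rw [schwarz, H.injOn.leftInvOn_invFunOn (by simpa using hz)]

lemma coe_mem_tileLevel_le_iff (n : ℕ) (w : ℂ) :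
    (∃ k ≤ n, (w : Sphere) ∈ tileLevel a k) ↔ w ∈ escSet a n := by
  induction n generalizing w with
  | zero =>
    rw [← coe_mem_droplet]
    constructor
    · rintro ⟨k, hk, h⟩
      obtain rfl : k = 0 := by omega
      exact h
    · exact fun h => ⟨0, le_rfl, h⟩
  | succ n ih =>
    constructor
    · rintro ⟨k, hk, h⟩
      cases k with
      | zero => exact escSet_zero_subset a _ (coe_mem_droplet.1 h)
      | succ k =>
        obtain ⟨w', ⟨hw', hs⟩, hww⟩ := h
        obtain rfl : w' = w := OnePoint.coe_injective hww
        rw [H.closure_domainΩ] at hw'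
        obtain ⟨z, hz, rfl⟩ := hw'
        have hz' : ‖z‖ ≤ 1 := by simpa using hz
        refine Or.inr ⟨z, hz', rfl, fun hz0 => ?_⟩
        rw [H.schwarz_chebA hz', reflect_coe hz0, chebSphere_coe] at hs
        exact (ih _).1 ⟨k, by omega, hs⟩
    · rintro (h | ⟨z, hz, rfl, h⟩)
      · exact ⟨0, by omega, coe_mem_droplet.2 h⟩
      · have hcl : chebA a z ∈ closure (domainΩ a) :=
          H.closure_domainΩ ▸ ⟨z, by simpa using hz, rfl⟩
        by_cases hz0 : z = 0
        · subst hz0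
          refine ⟨1, by omega, _, ⟨hcl, ?_⟩, rfl⟩
          rw [H.schwarz_chebA hz, reflect_zero, chebSphere_infty]
          exact infty_mem_droplet a
        · obtain ⟨k, hk, hk'⟩ := (ih _).2 (h hz0)
          refine ⟨k + 1, by omega, _, ⟨hcl, ?_⟩, rfl⟩
          rw [H.schwarz_chebA hz, reflect_coe hz0, chebSphere_coe]
          exact hk'

lemma coe_mem_tilingSet {w : ℂ} : (w : Sphere) ∈ tilingSet a ↔ w ∈ finTiling a := by
  simp only [tilingSet, finTiling, mem_iUnion]
  constructor
  · rintro ⟨n, h⟩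
    exact ⟨n, (H.coe_mem_tileLevel_le_iff n w).1 ⟨n, le_rfl, h⟩⟩
  · rintro ⟨n, h⟩
    obtain ⟨k, -, hk⟩ := (H.coe_mem_tileLevel_le_iff n w).2 h
    exact ⟨k, hk⟩

omit H in
lemma infty_mem_tilingSet : (OnePoint.infty : Sphere) ∈ tilingSet a :=
  mem_iUnion.2 ⟨0, infty_mem_droplet a⟩

omit H in
lemma escSet_subset_finTiling (n : ℕ) : escSet a n ⊆ finTiling a := subset_iUnion _ n

lemma neg_two_not_mem_finTiling : (-2 : ℂ) ∉ finTiling a := by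
  simp only [finTiling, mem_iUnion, not_exists]
  exact H.neg_two_not_mem_escSet

lemma isPreconnected_finTiling : IsPreconnected (finTiling a) :=
  isPreconnected_iUnion ⟨chebA a (-1), mem_iInter.2 fun n => escSet_zero_subset a n H.neg_one_mem⟩
    H.isPreconnected_escSet

lemma isPreconnected_preimage_finTiling : IsPreconnected (chebA a ⁻¹' finTiling a) :=
  H.isPreconnected_preimage H.isPreconnected_finTiling (escSet_subset_finTiling 0)

lemma conj_inv_mem_of_mem {z : ℂ} (hz0 : z ≠ 0) (hz : chebA a z ∈ finTiling a) :
    chebA a (conj z)⁻¹ ∈ finTiling a := by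
  obtain ⟨n, hn⟩ := mem_iUnion.1 hz
  rcases le_total ‖z‖ 1 with h | h
  · exact mem_iUnion.2 ⟨n, (H.chebA_mem_succ_iff h hz0 n).1 (escSet_subset_succ a n hn)⟩
  · refine mem_iUnion.2 ⟨n + 1, (H.chebA_mem_succ_iff ?_ (by simpa using hz0) n).2 ?_⟩
    · rw [norm_conj_inv]; exact inv_le_one_of_one_le₀ h
    · rwa [conj_inv_conj_inv]

end IsUnivalentParam

/-! ### Square roots along paths and off paths -/

/-- A path in the plane ending at `0`, stopped when it first reaches `0`, has a continuous square
root with any prescribed initial value. -/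
lemma exists_sqrt_path {h : ℝ → ℂ} (hc : Continuous h) (h1 : h 1 = 0) {m₀ : ℂ}
    (hm₀ : m₀ ^ 2 = h 0) : ∃ (c : ℝ) (m : ℝ → ℂ), c ∈ Icc (0 : ℝ) 1 ∧ h c = 0 ∧
      ContinuousOn m (Icc 0 1) ∧ m 0 = m₀ ∧ m 1 = 0 ∧ ∀ t ∈ Icc (0 : ℝ) 1, m t ^ 2 = h (c * t) := by
  -- `c` is the first zero of `h`
  have hZ : IsCompact (Icc (0 : ℝ) 1 ∩ h ⁻¹' {0}) :=
    isCompact_Icc.inter_right (isClosed_singleton.preimage hc)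
  obtain ⟨c, ⟨hcI, hc0⟩, hcmin⟩ := hZ.exists_isLeast ⟨1, by simp, h1⟩
  have hc0' : h c = 0 := hc0
  by_cases hpos : c = 0
  · subst hpos
    have hm : m₀ = 0 := by rw [hc0'] at hm₀; exact pow_eq_zero_iff two_ne_zero |>.1 hm₀
    exact ⟨0, fun _ => 0, hcI, hc0', continuousOn_const, hm.symm, rfl, fun t _ => by simp [hc0']⟩
  have hcpos : 0 < c := lt_of_le_of_ne hcI.1 (Ne.symm hpos)
  have hne : ∀ t < (1 : ℝ), h (c * max t 0) ≠ 0 := by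
    intro t ht h0
    have h2 : max t 0 < 1 := max_lt ht one_pos
    have h3 : c * max t 0 < c := mul_lt_of_lt_one_right hcpos h2
    exact absurd (hcmin ⟨⟨mul_nonneg hcI.1 (le_max_right _ _), h3.le.trans hcI.2⟩, h0⟩)
      (not_le.2 h3)
  have : ContractibleSpace (Iio (1 : ℝ)) := (convex_Iio 1).contractibleSpace ⟨0, mem_Iio.2 one_pos⟩
  have : LocallyPathConnectedSpace (Iio (1 : ℝ)) := isOpen_Iio.locallyPathConnectedSpace
  have hcov := isCoveringMapOn_npow (𝕜 := ℂ) 2 (by norm_num)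
  obtain ⟨M, ⟨hM0, hM⟩, -⟩ := hcov.existsUnique_continuousMap_lifts (A := Iio (1 : ℝ))
    ⟨fun t => h (c * max t.1 0), by fun_prop⟩ (a₀ := ⟨0, mem_Iio.2 one_pos⟩) (e₀ := m₀)
    (by simp [hm₀]) (fun t => hne t.1 t.2)
  have hM' : ∀ t : Iio (1 : ℝ), M t ^ 2 = h (c * max t.1 0) := fun t => congr_fun hM t
  let m : ℝ → ℂ := fun t => if ht : t < 1 then M ⟨t, ht⟩ else 0
  have hmlt : ∀ t (ht : t < 1), m t = M ⟨t, ht⟩ := fun t ht => dif_pos ht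
  have hm1 : m 1 = 0 := dif_neg (lt_irrefl _)
  have hsq : ∀ t ≤ 1, m t ^ 2 = h (c * max t 0) := by
    intro t ht
    rcases ht.lt_or_eq with ht | rfl
    · rw [hmlt t ht, hM']
    · rw [hm1]; simp [hc0']
  refine ⟨c, m, hcI, hc0', ?_, ?_, hm1, ?_⟩
  · rintro t ⟨ht0, ht1⟩
    rcases ht1.lt_or_eq with ht | rfl
    · have h2 : ContinuousOn m (Iio 1) := by
        rw [continuousOn_iff_continuous_domRestrict]
        have : (Iio (1 : ℝ)).domRestrict m = M := funext fun t => hmlt t.1 t.2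
        rw [this]; exact M.continuous
      exact (h2.continuousAt (Iio_mem_nhds ht)).continuousWithinAt
    · -- at the first zero the square root is continuous because its modulus is
      rw [ContinuousWithinAt, hm1, tendsto_zero_iff_norm_tendsto_zero]
      have h3 : Tendsto (fun t : ℝ => √‖h (c * max t 0)‖) (𝓝[Icc 0 1] 1) (𝓝 0) := by
        have : Continuous fun t : ℝ => √‖h (c * max t 0)‖ := by fun_prop
        have h4 := (this.tendsto 1).mono_left (nhdsWithin_le_nhds (s := Icc (0 : ℝ) 1))
        simpa [hc0'] using h4
      refine h3.congr' ?_
      filter_upwards [self_mem_nhdsWithin] with t ht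
      rw [← hsq t ht.2, norm_pow, Real.sqrt_sq (norm_nonneg _)]
  · rw [hmlt 0 one_pos]; exact hM0
  · intro t ht
    rw [hsq t ht.2, max_eq_left ht.1]

/-- If `p` and `q` are joined by a path off `E`, then `(w - q) / (w - p)` has a continuous square
root on `E`: lift the homotopy `(w - γ(t)) / (w - p)` through the squaring map. -/
lemma exists_sqrt_of_joinedIn {E : Set ℂ} {p q : ℂ} (h : JoinedIn Eᶜ p q) :
    ∃ s : ℂ → ℂ, ContinuousOn s E ∧ ∀ w ∈ E, s w ^ 2 = (w - q) / (w - p) := by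
  have hne : ∀ (t : unitInterval) (w : E), (w : ℂ) - h.somePath t ≠ 0 := by
    intro t w hw
    have h1 := h.somePath_mem t
    rw [← sub_eq_zero.1 hw] at h1
    exact h1 w.2
  have hp : ∀ w : E, (w : ℂ) - p ≠ 0 := by
    intro w
    simpa using hne 0 w
  let F : C(unitInterval × E, {x : ℂ // x ≠ 0}) :=
    ⟨fun x => ⟨((x.2 : ℂ) - h.somePath x.1) / ((x.2 : ℂ) - p), div_ne_zero (hne _ _) (hp _)⟩, by
      have h1 : Continuous fun x : unitInterval × E => ((x.2 : ℂ) - h.somePath x.1) / (x.2 - p) :=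
        Continuous.div (by fun_prop) (by fun_prop) fun x => hp x.2
      exact h1.subtype_mk _⟩
  have hcov := isCoveringMap_npow (𝕜 := ℂ) 2 (by norm_num)
  let L := hcov.liftHomotopy F (ContinuousMap.const _ ⟨1, one_ne_zero⟩) (by
    intro w
    ext
    simp [F, div_self (hp w)])
  have hL := hcov.liftHomotopy_lifts (H := F) (f := ContinuousMap.const _ ⟨1, one_ne_zero⟩) (by
    intro w
    ext
    simp [F, div_self (hp w)])
  classical
  refine ⟨fun w => if hw : w ∈ E then (L (1, ⟨w, hw⟩) : ℂ) else 0, ?_, ?_⟩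
  · rw [continuousOn_iff_continuous_domRestrict]
    have : E.domRestrict (fun w => if hw : w ∈ E then (L (1, ⟨w, hw⟩) : ℂ) else 0) =
        fun w : E => (L (1, w) : ℂ) := funext fun w => dif_pos w.2
    rw [this]
    fun_prop
  · intro w hw
    simp only [dif_pos hw]
    have h1 : (L (1, ⟨w, hw⟩) : ℂ) ^ 2 = (w - h.somePath 1) / (w - p) :=
      congrArg Subtype.val (congr_fun hL (1, ⟨w, hw⟩))
    simpa using h1

/-- Lifting paths through the two-valued sibling correspondence: a path ending at the critical
point over `2` can be lifted from any sibling of its origin, and the lift ends at the other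
critical point. -/
lemma joinedIn_siblings {a : ℂ} (ha : a ≠ 1) {N : Set ℂ} (hN : ∀ x ∈ N, affA a x ≠ -2) {x y : ℂ}
    (hx : JoinedIn N x (affInv a 2)) (hs : sib a x y = 0) :
    JoinedIn {y | ∃ x ∈ N, sib a x y = 0} y (affInv a (-1)) := by
  let X : ℝ → ℂ := fun t => affA a (hx.somePath.extend t)
  have hXc : Continuous X := (continuous_affA a).comp hx.somePath.continuous_extend
  have hX0 : X 0 = affA a x := by simp [X]
  have hX1 : X 1 = 2 := by simp [X, affA_affInv ha]
  have hmem : ∀ t ∈ Icc (0 : ℝ) 1, hx.somePath.extend t ∈ N := by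
    intro t ht
    rw [Path.extend_apply _ ht]
    exact hx.somePath_mem _
  obtain ⟨c, m, hc, hhc, hmc, hm0, hm1, hm⟩ := exists_sqrt_path (h := fun t => 12 - 3 * X t ^ 2)
    (m₀ := 2 * affA a y + affA a x) (by fun_prop) (by rw [hX1]; norm_num) (by
      rw [hX0]; simp only [sib] at hs; linear_combination 4 * hs)
  have hXc2 : X c = 2 := by
    have h1 : (X c - 2) * (X c + 2) = 0 := by linear_combination -hhc / 3
    rcases mul_eq_zero.1 h1 with h1 | h1
    · exact sub_eq_zero.1 h1
    · exact absurd (eq_neg_of_add_eq_zero_left h1) (hN _ (hmem c hc))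
  refine JoinedIn.ofLine (f := fun t => affInv a ((m t - X (c * t)) / 2)) ?_ ?_ ?_ ?_
  · exact (continuous_affInv a).comp_continuousOn ((hmc.sub (by fun_prop)).div_const 2)
  · simp only [mul_zero, hm0, hX0]
    apply affA_injective ha
    rw [affA_affInv ha]; ring
  · simp only [mul_one, hm1, hXc2]
    norm_num
  · rintro _ ⟨t, ht, rfl⟩
    have hct : c * t ∈ Icc (0 : ℝ) 1 :=
      ⟨mul_nonneg hc.1 ht.1, mul_le_one₀ hc.2 ht.1 ht.2⟩
    refine ⟨_, hmem _ hct, ?_⟩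
    simp only [sib, affA_affInv ha]
    change X (c * t) ^ 2 + X (c * t) * _ + _ - 3 = 0
    linear_combination (hm t ht) / 4

/-! ### The non-escaping part of the disk is path connected -/

/-- The points of the open disk, and the cusp point `1`, whose image does not belong to the escape
level `n`. -/
def stayDisk (a : ℂ) (n : ℕ) : Set ℂ := {z | (‖z‖ < 1 ∨ z = 1) ∧ chebA a z ∉ escSet a n}

namespace IsUnivalentParam

variable {a : ℂ} (H : IsUnivalentParam a)
include H

lemma norm_affInv_two : ‖affInv a 2‖ < 1 := by
  rw [affInv_lt_one_iff H.ne_one]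
  have := real_sub_norm_lt (a := a) 2 (by nlinarith [H.re_gt])
  simpa using this

lemma chebA_affInv_two : chebA a (affInv a 2) = 2 := by
  rw [chebA_eq, affA_affInv H.ne_one]; norm_num

omit H in
lemma norm_le_of_mem_stayDisk {n : ℕ} {z : ℂ} (h : z ∈ stayDisk a n) : ‖z‖ ≤ 1 := by
  rcases h.1 with h | h
  · exact h.le
  · rw [h]; simp

lemma one_mem_stayDisk (n : ℕ) : (1 : ℂ) ∈ stayDisk a n :=
  ⟨Or.inr rfl, chebA_one a ▸ H.neg_two_not_mem_escSet n⟩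

lemma affInv_two_mem_stayDisk (h2 : (2 : ℂ) ∉ finTiling a) (n : ℕ) :
    affInv a 2 ∈ stayDisk a n := by
  refine ⟨Or.inl H.norm_affInv_two, ?_⟩
  rw [H.chebA_affInv_two]
  exact fun h => h2 (escSet_subset_finTiling n h)

lemma affA_ne_neg_two {n : ℕ} {z : ℂ} (h : z ∈ stayDisk a n) : affA a z ≠ -2 := fun h1 =>
  absurd (one_lt_norm_of_affA_eq_neg_two H.re_pos h1) (not_lt.2 (norm_le_of_mem_stayDisk h))

/-- The reflection carries siblings of points of level `n` to points of level `n + 1`. -/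
lemma conj_inv_mem_stayDisk {n : ℕ} {x y : ℂ} (hx : x ∈ stayDisk a n) (hs : sib a x y = 0) :
    y ≠ 0 ∧ (conj y)⁻¹ ∈ stayDisk a (n + 1) := by
  have hy : 1 < ‖y‖ ∨ y = 1 := by
    by_contra! hcon
    have h1 := H.eq_of_chebA_eq (norm_le_of_mem_stayDisk hx) hcon.1 (chebA_eq_of_sib hs)
    rw [h1] at hs
    exact hcon.2 (sib_self_of_norm_le H.ne_one H.re_pos hcon.1 hs)
  have hy1 : 1 ≤ ‖y‖ := hy.elim le_of_lt (fun h => by rw [h]; simp)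
  have hy0 : y ≠ 0 := norm_pos_iff.1 (by linarith)
  refine ⟨hy0, hy.imp ?_ ?_, ?_⟩
  · intro h
    rw [norm_conj_inv]; exact inv_lt_one_of_one_lt₀ h
  · rintro rfl; simp
  · rw [H.chebA_mem_succ_iff (by rw [norm_conj_inv]; exact inv_le_one_of_one_le₀ hy1)
      (by simpa using hy0), conj_inv_conj_inv, ← chebA_eq_of_sib hs]
    exact hx.2

lemma exists_sibling {n : ℕ} {z : ℂ} (hz : z ∈ stayDisk a (n + 1)) :
    z ≠ 0 ∧ ∃ x ∈ stayDisk a n, sib a x (conj z)⁻¹ = 0 := by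
  have hz1 := norm_le_of_mem_stayDisk hz
  have hz0 : z ≠ 0 := by
    rintro rfl
    exact hz.2 (chebA_zero_mem n)
  refine ⟨hz0, ?_⟩
  have hy := hz.2
  rw [H.chebA_mem_succ_iff hz1 hz0] at hy
  rcases hz.1 with h | rfl
  swap
  · exact ⟨1, H.one_mem_stayDisk n, by simp [sib, affA_one]; norm_num⟩
  have hy1 : 1 < ‖(conj z)⁻¹‖ := by
    rw [norm_conj_inv]; exact (one_lt_inv₀ (norm_pos_iff.2 hz0)).2 h
  have hy0 : chebA a (conj z)⁻¹ ∉ escSet a 0 := fun h => hy (escSet_zero_subset a n h)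
  obtain ⟨x, hx, hxy⟩ : ∃ x : ℂ, (‖x‖ < 1 ∨ x = 1) ∧ chebA a x = chebA a (conj z)⁻¹ := by
    by_cases h3 : chebA a (conj z)⁻¹ ∈ domainΩ a
    · obtain ⟨x, hx, hxy⟩ := H.exists_of_mem_domainΩ h3
      exact ⟨x, Or.inl hx, hxy⟩
    · refine ⟨1, Or.inr rfl, ?_⟩
      rw [chebA_one]
      by_contra h4
      exact hy0 ⟨h3, fun h => h4 h.symm⟩
  have hxs : x ∈ stayDisk a n := ⟨hx, hxy ▸ hy⟩
  refine ⟨x, hxs, sib_eq_zero H.ne_one hxy ?_⟩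
  rintro rfl
  exact absurd (norm_le_of_mem_stayDisk hxs) (not_le.2 hy1)

/-- The preimage in the disk of the complement of an escape level is path connected if the critical
value does not escape. The next level is the reflection of the set of siblings of the present
one; that set is a double cover branched over the critical point `2`, so it is path connected. -/
theorem joinedIn_stayDisk (h2 : (2 : ℂ) ∉ finTiling a) (n : ℕ) :
    ∀ z ∈ stayDisk a n, JoinedIn (stayDisk a n) z (affInv a 2) := by
  induction n with
  | zero =>
    intro z hz
    apply JoinedIn.of_segment_subset
    intro x hx
    have hmem : ∀ x : ℂ, (‖x‖ < 1 ∨ x = 1) → x ∈ stayDisk a 0 := by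
      rintro x (hx | rfl)
      · exact ⟨Or.inl hx, fun h => h.1 ((H.mem_domainΩ_iff hx.le).2 hx)⟩
      · exact H.one_mem_stayDisk 0
    have hc : ‖affInv a 2‖ < 1 := H.norm_affInv_two
    rw [segment_eq_image] at hx
    obtain ⟨t, ht, rfl⟩ := hx
    apply hmem
    rcases eq_or_lt_of_le ht.1 with h0 | h0
    · rw [← h0]; simpa using hz.1
    · left
      have hz1 := norm_le_of_mem_stayDisk hz
      calc ‖(1 - t) • z + t • affInv a 2‖ ≤ ‖(1 - t) • z‖ + ‖t • affInv a 2‖ := norm_add_le _ _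
        _ = (1 - t) * ‖z‖ + t * ‖affInv a 2‖ := by
          rw [norm_smul, norm_smul, Real.norm_of_nonneg (by linarith [ht.2]),
            Real.norm_of_nonneg ht.1]
        _ < 1 := by nlinarith [ht.2]
  | succ n ih =>
    have key : ∀ z ∈ stayDisk a (n + 1),
        JoinedIn (stayDisk a (n + 1)) z (conj (affInv a (-1)))⁻¹ := by
      intro z hz
      obtain ⟨hz0, x, hx, hs⟩ := H.exists_sibling hz
      have h1 := joinedIn_siblings H.ne_one (fun x hx => H.affA_ne_neg_two hx) (ih x hx) hs
      have h2 := h1.map_continuousOn (f := fun y => (conj y)⁻¹) (by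
        refine ContinuousOn.inv₀ Complex.continuous_conj.continuousOn ?_
        rintro y ⟨x, hx, hs⟩
        simpa using (H.conj_inv_mem_stayDisk hx hs).1)
      simp only [conj_inv_conj_inv] at h2
      refine h2.mono ?_
      rintro _ ⟨y, ⟨x, hx, hs⟩, rfl⟩
      exact (H.conj_inv_mem_stayDisk hx hs).2
    intro z hz
    exact (key z hz).trans (key _ (H.affInv_two_mem_stayDisk h2 _)).symm

/-! ### The square root of `(w + 2) / (w - 2)` on the tiling set -/

lemma exists_sqrt_escSet (h2 : (2 : ℂ) ∉ finTiling a) (n : ℕ) :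
    ∃ s : ℂ → ℂ, ContinuousOn s (escSet a n) ∧
      ∀ w ∈ escSet a n, s w ^ 2 = (w + 2) / (w - 2) := by
  have h1 := (H.joinedIn_stayDisk h2 n 1 (H.one_mem_stayDisk n)).symm.map (continuous_chebA a)
  rw [H.chebA_affInv_two, chebA_one] at h1
  have h3 : JoinedIn (escSet a n)ᶜ 2 (-2) := by
    refine h1.mono ?_
    rintro _ ⟨z, hz, rfl⟩
    exact hz.2
  obtain ⟨s, hs, hs'⟩ := exists_sqrt_of_joinedIn h3
  exact ⟨s, hs, fun w hw => by rw [hs' w hw, sub_neg_eq_add]⟩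

theorem exists_sqrt_finTiling (h2 : (2 : ℂ) ∉ finTiling a) :
    ∃ s : ℂ → ℂ, ContinuousOn s (finTiling a) ∧
      ∀ w ∈ finTiling a, s w ^ 2 = (w + 2) / (w - 2) := by
  choose s₀ hs₀c hs₀ using H.exists_sqrt_escSet h2
  set w₀ := chebA a (-1) with hw₀def
  have hw₀ : ∀ n, w₀ ∈ escSet a n := fun n => escSet_zero_subset a n H.neg_one_mem
  -- normalize the branches at a base point, so that they agree
  have hnorm : ∀ n, ∃ s : ℂ → ℂ, ContinuousOn s (escSet a n) ∧
      (∀ w ∈ escSet a n, s w ^ 2 = (w + 2) / (w - 2)) ∧ s w₀ = s₀ 0 w₀ := by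
    intro n
    have h1 : s₀ n w₀ ^ 2 = s₀ 0 w₀ ^ 2 := by rw [hs₀ n _ (hw₀ n), hs₀ 0 _ (hw₀ 0)]
    rcases sq_eq_sq_iff_eq_or_eq_neg.1 h1 with h1 | h1
    · exact ⟨s₀ n, hs₀c n, hs₀ n, h1⟩
    · exact ⟨fun w => -s₀ n w, (hs₀c n).neg, fun w hw => by rw [neg_sq, hs₀ n w hw],
        by simp only [h1, neg_neg]⟩
  choose s hsc hs hsw using hnorm
  have hne : ∀ n, ∀ w ∈ escSet a n, s n w ≠ 0 := by
    intro n w hw h0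
    have h1 := hs n w hw
    rw [h0, zero_pow two_ne_zero] at h1
    rcases div_eq_zero_iff.1 h1.symm with h | h
    · exact H.neg_two_not_mem_escSet n (eq_neg_of_add_eq_zero_left h ▸ hw)
    · exact h2 (escSet_subset_finTiling n (sub_eq_zero.1 h ▸ hw))
  have hagree : ∀ n m, n ≤ m → EqOn (s m) (s n) (escSet a n) := by
    intro n m hnm
    have hsub := escSet_mono a hnm
    refine (H.isPreconnected_escSet n).eq_of_sq_eq ((hsc m).mono hsub) (hsc n) ?_
      (fun {w} hw => hne n w hw) (hw₀ n) ((hsw m).trans (hsw n).symm)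
    intro w hw
    simp only [Pi.pow_apply, hs n w hw, hs m w (hsub hw)]
  classical
  let S : ℂ → ℂ := fun w => if h : ∃ n, w ∈ escSet a n then s (Nat.find h) w else 0
  have hS : ∀ n, EqOn S (s n) (escSet a n) := by
    intro n w hw
    have h : ∃ n, w ∈ escSet a n := ⟨n, hw⟩
    simp only [S, dif_pos h]
    exact (hagree _ _ (Nat.find_min' h hw) (Nat.find_spec h)).symm
  refine ⟨S, ?_, ?_⟩
  · intro w hw
    obtain ⟨n, hn⟩ := mem_iUnion.1 hw
    have h1 : escSet a (n + 1) ∈ 𝓝 w := mem_interior_iff_mem_nhds.1 (H.escSet_subset_interior n hn)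
    have h3 : ContinuousAt S w :=
      ((hsc (n + 1)).continuousAt h1).congr (mem_of_superset h1 fun x hx => (hS (n + 1) hx).symm)
    exact h3.continuousWithinAt
  · intro w hw
    obtain ⟨n, hn⟩ := mem_iUnion.1 hw
    rw [hS n hn, hs n w hn]

end IsUnivalentParam

/-! ### The deck transformation in the plane -/

lemma sibling_of_sq_eq {u σ : ℂ} (hu : u - 1 ≠ 0)
    (hσ : σ ^ 2 * ((u + 1) ^ 2 * (u - 2)) = -3 * ((u - 1) ^ 2 * (u + 2))) :
    u ^ 2 + u * (((u - 2) * (u + 1) / (u - 1) * σ - u) / 2) +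
      (((u - 2) * (u + 1) / (u - 1) * σ - u) / 2) ^ 2 - 3 = 0 := by
  have h1 : ((u - 2) * (u + 1) / (u - 1) * σ) ^ 2 = 12 - 3 * u ^ 2 := by
    rw [mul_pow, div_pow, div_mul_eq_mul_div, div_eq_iff (pow_ne_zero 2 hu)]
    linear_combination (u - 2) * hσ
  linear_combination h1 / 4

/-- With the same value of `σ`, the second application of the deck transformation gives the third
point of the fiber. -/
lemma second_sibling {u v σ : ℂ} (hu1 : u - 1 ≠ 0) (hu2 : u - 2 ≠ 0) (hu3 : u + 1 ≠ 0)
    (hv1 : v - 1 ≠ 0) (hv : v = ((u - 2) * (u + 1) / (u - 1) * σ - u) / 2)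
    (hQ : u ^ 2 + u * v + v ^ 2 - 3 = 0) :
    ((v - 2) * (v + 1) / (v - 1) * σ - v) / 2 = -u - v := by
  have hσ : σ = (2 * v + u) * (u - 1) / ((u - 2) * (u + 1)) := by
    rw [eq_div_iff (mul_ne_zero hu2 hu3), hv]
    field_simp
    ring
  have h1 : (v - 2) * (v + 1) / (v - 1) * σ = -(2 * u + v) := by
    rw [hσ, div_mul_div_comm, div_eq_iff (mul_ne_zero hv1 (mul_ne_zero hu2 hu3))]
    linear_combination (2 * u * v - 2 * (u + v)) * hQ
  rw [h1]; ring

namespace IsUnivalentParam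

variable {a : ℂ} (H : IsUnivalentParam a)
include H

lemma affA_ne_of_mem (h2 : (2 : ℂ) ∉ finTiling a) {z : ℂ} (hz : chebA a z ∈ finTiling a) :
    affA a z - 1 ≠ 0 ∧ affA a z - 2 ≠ 0 ∧ affA a z + 1 ≠ 0 := by
  refine ⟨fun h => ?_, fun h => ?_, fun h => ?_⟩ <;> rw [chebA_eq] at hz
  · rw [sub_eq_zero.1 h] at hz
    norm_num at hz
    exact H.neg_two_not_mem_finTiling hz
  · rw [sub_eq_zero.1 h] at hz
    norm_num at hz
    exact h2 hz
  · rw [eq_neg_of_add_eq_zero_left h] at hz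
    norm_num at hz
    exact h2 hz

lemma sib_self_ne_of_mem (h2 : (2 : ℂ) ∉ finTiling a) {z : ℂ} (hz : chebA a z ∈ finTiling a) :
    sib a z z ≠ 0 := by
  intro h
  obtain ⟨h1, -, h3⟩ := H.affA_ne_of_mem h2 hz
  rcases sib_self h with h | h
  · exact h1 (sub_eq_zero.2 h)
  · exact h3 (by rw [h]; ring)

/-- Existence of the deck transformation: the other two roots `v` of `f(v) = f(u)` are
`(-u ± √(12 - 3u²)) / 2`, and the branch of the square root of `(w + 2) / (w - 2)` selects one
of them continuously. -/
theorem exists_planar_deck (h2 : (2 : ℂ) ∉ finTiling a) :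
    ∃ t : ℂ → ℂ, ContinuousOn t (chebA a ⁻¹' finTiling a) ∧ (∀ z, chebA a (t z) = chebA a z) ∧
      ∀ z, chebA a z ∈ finTiling a → t z ≠ z ∧ t (t (t z)) = z := by
  obtain ⟨s, hsc, hs⟩ := H.exists_sqrt_finTiling h2
  obtain ⟨κ, hκ⟩ : ∃ κ : ℂ, κ ^ 2 = -3 := IsAlgClosed.exists_pow_nat_eq (-3) two_pos
  let V : ℂ → ℂ := fun z => ((affA a z - 2) * (affA a z + 1) / (affA a z - 1) *
    (κ * s (chebA a z)) - affA a z) / 2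
  classical
  let t : ℂ → ℂ := fun z => if chebA a z ∈ finTiling a then affInv a (V z) else z
  have ht : ∀ z, chebA a z ∈ finTiling a → t z = affInv a (V z) := fun z hz => if_pos hz
  have hV : ∀ z, chebA a z ∈ finTiling a → affA a (t z) = V z := fun z hz => by
    rw [ht z hz, affA_affInv H.ne_one]
  have hsib : ∀ z, chebA a z ∈ finTiling a → sib a z (t z) = 0 := by
    intro z hz
    obtain ⟨hu1, hu2, hu3⟩ := H.affA_ne_of_mem h2 hz
    rw [sib, hV z hz]
    refine sibling_of_sq_eq hu1 ?_
    have h1 := hs _ hz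
    have e1 : chebA a z + 2 = (affA a z - 1) ^ 2 * (affA a z + 2) := by rw [chebA_eq]; ring
    have e2 : chebA a z - 2 = (affA a z + 1) ^ 2 * (affA a z - 2) := by rw [chebA_eq]; ring
    rw [e1, e2, eq_div_iff (mul_ne_zero (pow_ne_zero 2 hu3) hu2)] at h1
    rw [mul_pow, hκ]
    linear_combination -3 * h1
  have hg : ∀ z, chebA a (t z) = chebA a z := by
    intro z
    by_cases hz : chebA a z ∈ finTiling a
    · exact (chebA_eq_of_sib (hsib z hz)).symm
    · simp only [t, if_neg hz]
  have htt : ∀ z, chebA a z ∈ finTiling a → affA a (t (t z)) = -affA a z - affA a (t z) := by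
    intro z hz
    have hz' : chebA a (t z) ∈ finTiling a := by rwa [hg]
    obtain ⟨hu1, hu2, hu3⟩ := H.affA_ne_of_mem h2 hz
    rw [hV _ hz']
    simp only [V, hg z]
    exact second_sibling hu1 hu2 hu3 (H.affA_ne_of_mem h2 hz').1 (hV z hz) (hsib z hz)
  refine ⟨t, ?_, hg, fun z hz => ⟨fun h => ?_, ?_⟩⟩
  · have hVc : ContinuousOn V (chebA a ⁻¹' finTiling a) := by
      have h3 : ContinuousOn (fun z => s (chebA a z)) (chebA a ⁻¹' finTiling a) :=
        hsc.comp (continuous_chebA a).continuousOn (mapsTo_preimage _ _)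
      have h4 : ContinuousOn (fun z => (affA a z - 2) * (affA a z + 1) / (affA a z - 1))
          (chebA a ⁻¹' finTiling a) :=
        ContinuousOn.div (by fun_prop) (by fun_prop) fun z hz => (H.affA_ne_of_mem h2 hz).1
      exact ((h4.mul (continuousOn_const.mul h3)).sub (by fun_prop)).div_const 2
    exact ((continuous_affInv a).comp_continuousOn hVc).congr fun z hz => ht z hz
  · have h3 := hsib z hz
    rw [h] at h3
    exact H.sib_self_ne_of_mem h2 hz h3
  · have hz' : chebA a (t z) ∈ finTiling a := by rwa [hg]
    apply affA_injective H.ne_one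
    rw [htt _ hz', htt z hz]; ring

end IsUnivalentParam

/-! ### Homeomorphisms of the lifted tiling set -/

lemma reflect_reflect (x : Sphere) : reflect (reflect x) = x := by
  induction x using OnePoint.rec with
  | infty => rw [reflect_infty, reflect_zero]
  | coe z =>
    by_cases hz : z = 0
    · rw [hz, reflect_zero, reflect_infty]
    · rw [reflect_coe hz, reflect_coe (by simpa using hz), conj_inv_conj_inv]

lemma continuous_reflect : Continuous reflect := by
  rw [OnePoint.continuous_iff, coclosedCompact_eq_cocompact, ← Metric.cobounded_eq_cocompact]
  constructor
  · have h1 : Tendsto (fun z : ℂ => (conj z)⁻¹) (Bornology.cobounded ℂ) (𝓝 0) := by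
      rw [tendsto_zero_iff_norm_tendsto_zero]
      simp only [norm_conj_inv]
      exact tendsto_inv_atTop_zero.comp tendsto_norm_cobounded_atTop
    have h2 := (OnePoint.continuous_coe.tendsto (0 : ℂ)).comp h1
    refine h2.congr' ?_
    filter_upwards [tendsto_norm_cobounded_atTop.eventually_gt_atTop 0] with z hz
    exact (reflect_coe (norm_pos_iff.1 hz)).symm
  · rw [continuous_iff_continuousAt]
    intro z
    by_cases hz : z = 0
    · subst hz
      rw [continuousAt_iff_punctured_nhds, reflect_zero]
      have h1 : Tendsto (fun z : ℂ => (conj z)⁻¹) (𝓝[≠] 0) (Bornology.cobounded ℂ) := by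
        rw [← tendsto_norm_atTop_iff_cobounded]
        simp only [norm_conj_inv]
        exact tendsto_inv_nhdsGT_zero.comp tendsto_norm_nhdsNE_zero
      have h2 := (OnePoint.tendsto_coe_infty (X := ℂ))
      rw [coclosedCompact_eq_cocompact, ← Metric.cobounded_eq_cocompact] at h2
      refine (h2.comp h1).congr' ?_
      filter_upwards [self_mem_nhdsWithin] with z hz
      exact (reflect_coe hz).symm
    · have h1 : ContinuousAt (fun z : ℂ => (((conj z)⁻¹ : ℂ) : Sphere)) z :=
        OnePoint.continuous_coe.continuousAt.comp
          (Complex.continuous_conj.continuousAt.inv₀ (by simpa using hz))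
      refine h1.congr ?_
      filter_upwards [isOpen_ne.mem_nhds hz] with x hx
      exact (reflect_coe hx).symm

/-- A map that preserves the fibers of `f_a` tends to infinity at infinity. -/
lemma tendsto_cocompact_of_chebA_eq {a : ℂ} (ha : a ≠ 1) {t : ℂ → ℂ}
    (ht : ∀ z, chebA a (t z) = chebA a z) : Tendsto t (cocompact ℂ) (cocompact ℂ) := by
  rw [hasBasis_cocompact.tendsto_right_iff]
  intro K hK
  obtain ⟨C, hC⟩ := (hK.image (continuous_chebA a)).isBounded.exists_norm_le
  filter_upwards [(tendsto_norm_chebA ha).eventually_gt_atTop C] with z hz hzK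
  rw [← ht z] at hz
  exact absurd (hC _ ⟨t z, hzK, rfl⟩) (not_le.2 hz)

namespace IsUnivalentParam

variable {a : ℂ} (H : IsUnivalentParam a)
include H

lemma coe_mem_liftedTiling {z : ℂ} : (z : Sphere) ∈ liftedTiling a ↔ chebA a z ∈ finTiling a := by
  rw [liftedTiling, mem_preimage, chebSphere_coe, H.coe_mem_tilingSet]

omit H in
lemma infty_mem_liftedTiling : (OnePoint.infty : Sphere) ∈ liftedTiling a := infty_mem_tilingSet

lemma coe_zero_mem_liftedTiling : ((0 : ℂ) : Sphere) ∈ liftedTiling a :=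
  H.coe_mem_liftedTiling.2 (escSet_subset_finTiling 1 (chebA_zero_mem 0))

lemma reflect_mem {x : Sphere} (hx : x ∈ liftedTiling a) : reflect x ∈ liftedTiling a := by
  induction x using OnePoint.rec with
  | infty => exact H.coe_zero_mem_liftedTiling
  | coe z =>
    by_cases hz : z = 0
    · rw [hz, reflect_zero]; exact infty_mem_liftedTiling
    · rw [reflect_coe hz, H.coe_mem_liftedTiling]
      exact H.conj_inv_mem_of_mem hz (H.coe_mem_liftedTiling.1 hx)

lemma reflect_mem_iff {x : Sphere} : reflect x ∈ liftedTiling a ↔ x ∈ liftedTiling a :=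
  ⟨fun h => reflect_reflect x ▸ H.reflect_mem h, H.reflect_mem⟩

/-- The reflection as a homeomorphism of the lifted tiling set. -/
noncomputable def reflectHomeo : liftedTiling a ≃ₜ liftedTiling a where
  toFun x := ⟨reflect x, H.reflect_mem x.2⟩
  invFun x := ⟨reflect x, H.reflect_mem x.2⟩
  left_inv x := Subtype.ext (reflect_reflect x)
  right_inv x := Subtype.ext (reflect_reflect x)
  continuous_toFun := (continuous_reflect.comp continuous_subtype_val).subtype_mk _
  continuous_invFun := (continuous_reflect.comp continuous_subtype_val).subtype_mk _

theorem exists_deck (h2 : (2 : ℂ) ∉ finTiling a) :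
    ∃ τ : liftedTiling a ≃ₜ liftedTiling a, IsOrderThreeDeck a τ := by
  obtain ⟨t, htc, htg, ht⟩ := H.exists_planar_deck h2
  have hcheb : ∀ x : Sphere, chebSphere a (OnePoint.map t x) = chebSphere a x := by
    intro x
    induction x using OnePoint.rec with
    | infty => rfl
    | coe z => rw [OnePoint.map_some, chebSphere_coe, chebSphere_coe, htg]
  have hmaps : MapsTo (OnePoint.map t) (liftedTiling a) (liftedTiling a) := by
    intro x hx
    rw [liftedTiling, mem_preimage, hcheb]
    exact hx
  have hcont : ContinuousOn (OnePoint.map t) (liftedTiling a) := by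
    intro x hx
    induction x using OnePoint.rec with
    | infty =>
      refine ContinuousAt.continuousWithinAt ?_
      rw [OnePoint.continuousAt_infty', OnePoint.map_infty]
      have h1 := tendsto_cocompact_of_chebA_eq H.ne_one htg
      rw [← coclosedCompact_eq_cocompact] at h1
      exact OnePoint.tendsto_coe_infty.comp h1
    | coe z =>
      rw [ContinuousWithinAt, OnePoint.nhdsWithin_coe, tendsto_map'_iff]
      have h1 : ((↑) : ℂ → Sphere) ⁻¹' liftedTiling a = chebA a ⁻¹' finTiling a := by
        ext z; exact H.coe_mem_liftedTiling
      rw [h1]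
      exact (OnePoint.continuous_coe.tendsto _).comp (htc z (H.coe_mem_liftedTiling.1 hx))
  let τ₀ : liftedTiling a → liftedTiling a := hmaps.restrict
  have hτ₀c : Continuous τ₀ := hcont.mapsToRestrict hmaps
  have hτ₀3 : ∀ x, τ₀ (τ₀ (τ₀ x)) = x := by
    rintro ⟨x, hx⟩
    apply Subtype.ext
    change OnePoint.map t (OnePoint.map t (OnePoint.map t x)) = x
    induction x using OnePoint.rec with
    | infty => rfl
    | coe z =>
      simp only [OnePoint.map_some]
      rw [(ht z (H.coe_mem_liftedTiling.1 hx)).2]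
  let τ : liftedTiling a ≃ₜ liftedTiling a :=
    { toFun := τ₀
      invFun := fun x => τ₀ (τ₀ x)
      left_inv := hτ₀3
      right_inv := hτ₀3
      continuous_toFun := hτ₀c
      continuous_invFun := hτ₀c.comp hτ₀c }
  have hτ3 : τ ^ 3 = 1 := by
    ext x
    exact congrArg Subtype.val (hτ₀3 x)
  have hτ1 : τ ≠ 1 := by
    intro h
    have h0 := H.coe_zero_mem_liftedTiling
    have h1 : τ₀ ⟨_, h0⟩ = ⟨_, h0⟩ := DFunLike.congr_fun h ⟨_, h0⟩
    have h3 : ((t 0 : ℂ) : Sphere) = ((0 : ℂ) : Sphere) := congrArg Subtype.val h1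
    exact (ht 0 (H.coe_mem_liftedTiling.1 h0)).1 (OnePoint.coe_injective h3)
  have : Fact (Nat.Prime 3) := ⟨Nat.prime_three⟩
  exact ⟨τ, fun z => hcheb z, orderOf_eq_prime hτ3 hτ1⟩

end IsUnivalentParam

/-! ### Free products and ping-pong -/

/-- The family with the two members `A` and `B`. -/
def TwoFactors (A B : Type) : Bool → Type
  | false => A
  | true => B

instance (A B : Type) [Group A] [Group B] : ∀ i, Group (TwoFactors A B i)
  | false => inferInstanceAs (Group A)
  | true => inferInstanceAs (Group B)

/-- The ping-pong lemma for a binary free product; the second factor has at least three elements. -/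
theorem coprod_lift_injective_of_ping_pong {A B G α : Type} [Group A] [Group B] [Group G]
    [MulAction G α] (φ : A →* G) (ψ : B →* G) (hB : ∃ b₁ b₂ : B, b₁ ≠ 1 ∧ b₂ ≠ 1 ∧ b₁ ≠ b₂)
    (X Y : Set α) (hX : X.Nonempty) (hY : Y.Nonempty) (hXY : Disjoint X Y)
    (hφ : ∀ x : A, x ≠ 1 → ∀ p ∈ Y, φ x • p ∈ X) (hψ : ∀ x : B, x ≠ 1 → ∀ p ∈ X, ψ x • p ∈ Y) :
    Function.Injective (Monoid.Coprod.lift φ ψ) := by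
  let f : ∀ i, TwoFactors A B i →* G := fun i => match i with
    | false => φ
    | true => ψ
  let Z : Bool → Set α := fun i => match i with
    | false => X
    | true => Y
  have hinj : Function.Injective (Monoid.CoprodI.lift f) := by
    refine Monoid.CoprodI.lift_injective_of_ping_pong f (Or.inr ⟨true, ?_⟩) Z ?_ ?_ ?_
    · obtain ⟨b₁, b₂, h1, h2, h12⟩ := hB
      have := Cardinal.mk_le_of_injective (α := Fin 3) (β := B) (f := ![1, b₁, b₂]) (by
        intro i j hij
        fin_cases i <;> fin_cases j <;> simp_all [eq_comm])
      change 3 ≤ Cardinal.mk B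
      simpa using this
    · intro i; cases i
      · exact hX
      · exact hY
    · intro i j hij; cases i <;> cases j <;> first | exact absurd rfl hij | skip
      · exact hXY
      · exact hXY.symm
    · intro i j hij h hh; cases i <;> cases j <;> first | exact absurd rfl hij | skip
      · rintro _ ⟨p, hp, rfl⟩
        exact hφ h hh p hp
      · rintro _ ⟨p, hp, rfl⟩
        exact hψ h hh p hp
  let oA : A →* Monoid.CoprodI (TwoFactors A B) :=
    Monoid.CoprodI.of (M := TwoFactors A B) (i := false)
  let oB : B →* Monoid.CoprodI (TwoFactors A B) :=
    Monoid.CoprodI.of (M := TwoFactors A B) (i := true)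
  let k : ∀ i, TwoFactors A B i →* Monoid.Coprod A B := fun i => match i with
    | false => (Monoid.Coprod.inl : A →* Monoid.Coprod A B)
    | true => (Monoid.Coprod.inr : B →* Monoid.Coprod A B)
  let η : Monoid.CoprodI (TwoFactors A B) →* Monoid.Coprod A B := Monoid.CoprodI.lift k
  have hηA : η.comp oA = Monoid.Coprod.inl :=
    MonoidHom.ext fun x => Monoid.CoprodI.lift_of (M := TwoFactors A B) (i := false) k x
  have hηB : η.comp oB = Monoid.Coprod.inr :=
    MonoidHom.ext fun x => Monoid.CoprodI.lift_of (M := TwoFactors A B) (i := true) k x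
  have hfA : (Monoid.CoprodI.lift f).comp oA = φ :=
    MonoidHom.ext fun x => Monoid.CoprodI.lift_of (M := TwoFactors A B) (i := false) _ x
  have hfB : (Monoid.CoprodI.lift f).comp oB = ψ :=
    MonoidHom.ext fun x => Monoid.CoprodI.lift_of (M := TwoFactors A B) (i := true) _ x
  have hθ : η.comp (Monoid.Coprod.lift oA oB) = MonoidHom.id _ := by
    apply Monoid.Coprod.hom_ext
    · rw [MonoidHom.comp_assoc, Monoid.Coprod.lift_comp_inl, hηA, MonoidHom.id_comp]
    · rw [MonoidHom.comp_assoc, Monoid.Coprod.lift_comp_inr, hηB, MonoidHom.id_comp]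
  have hcomp : Monoid.Coprod.lift φ ψ =
      (Monoid.CoprodI.lift f).comp (Monoid.Coprod.lift oA oB) := by
    apply Monoid.Coprod.hom_ext
    · rw [MonoidHom.comp_assoc, Monoid.Coprod.lift_comp_inl, Monoid.Coprod.lift_comp_inl, hfA]
    · rw [MonoidHom.comp_assoc, Monoid.Coprod.lift_comp_inr, Monoid.Coprod.lift_comp_inr, hfB]
  rw [hcomp]
  exact hinj.comp (Function.LeftInverse.injective (g := η) fun x => DFunLike.congr_fun hθ x)

/-- The homomorphism from `ℤ/n` to a group sending `1` to a given element `g` with `g ^ n = 1`. -/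
def zmodPowHom {G : Type} [Group G] (n : ℕ) [NeZero n] (g : G) (hg : g ^ n = 1) :
    Multiplicative (ZMod n) →* G where
  toFun x := g ^ x.toAdd.val
  map_one' := by simp
  map_mul' x y := by
    rw [toAdd_mul, ZMod.val_add, ← pow_eq_pow_mod _ hg, pow_add]

lemma zmodPowHom_ofAdd_one {G : Type} [Group G] (n : ℕ) [NeZero n] [Fact (1 < n)] (g : G)
    (hg : g ^ n = 1) : zmodPowHom n g hg (Multiplicative.ofAdd 1) = g := by
  simp [zmodPowHom, ZMod.val_one]

lemma range_zmodPowHom {G : Type} [Group G] (n : ℕ) [NeZero n] [Fact (1 < n)] (g : G)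
    (hg : g ^ n = 1) : (zmodPowHom n g hg).range = Subgroup.zpowers g := by
  apply le_antisymm
  · rintro _ ⟨x, rfl⟩
    exact Subgroup.npow_mem_zpowers g _
  · rw [Subgroup.zpowers_le]
    exact ⟨Multiplicative.ofAdd 1, zmodPowHom_ofAdd_one n g hg⟩

/-- Two elements of orders `2` and `3` that play ping-pong generate the free product of the groups
that each of them generates. -/
theorem free_product_of_ping_pong {G α : Type} [Group G] [MulAction G α] {I τ : G}
    (hI : I ^ 2 = 1) (hτ : orderOf τ = 3) (X Y : Set α) (hX : X.Nonempty) (hY : Y.Nonempty)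
    (hXY : Disjoint X Y) (hIY : ∀ p ∈ Y, I • p ∈ X) (hτX : ∀ p ∈ X, τ • p ∈ Y)
    (hτX2 : ∀ p ∈ X, τ ^ 2 • p ∈ Y) :
    Function.Injective (Monoid.Coprod.lift
      (Subgroup.zpowers I).subtype (Subgroup.zpowers τ).subtype) ∧
    (Monoid.Coprod.lift (Subgroup.zpowers I).subtype (Subgroup.zpowers τ).subtype).range =
      Subgroup.closure {I, τ} ∧
    ∃ φ : Monoid.Coprod (Multiplicative (ZMod 2)) (Multiplicative (ZMod 3)) ≃*
        Subgroup.closure {I, τ},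
      (φ (Monoid.Coprod.inl (Multiplicative.ofAdd 1)) : G) = I ∧
      (φ (Monoid.Coprod.inr (Multiplicative.ofAdd 1)) : G) = τ := by
  have hτ3 : τ ^ 3 = 1 := hτ ▸ pow_orderOf_eq_one τ
  have hI1 : I ≠ 1 := by
    rintro rfl
    obtain ⟨p, hp⟩ := hY
    have := hIY p hp
    rw [one_smul] at this
    exact disjoint_left.1 hXY this hp
  have hI2 : orderOf I = 2 := orderOf_eq_prime hI hI1
  have hτ1 : τ ≠ 1 := by
    rintro rfl
    simp at hτ
  have hτ2 : τ ^ 2 ≠ 1 := fun h => by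
    have := orderOf_le_of_pow_eq_one two_pos h
    omega
  have hτ12 : τ ≠ τ ^ 2 := fun h => hτ1 (by
    rw [pow_two] at h
    exact (left_eq_mul.1 h))
  have hcl : Subgroup.zpowers I ⊔ Subgroup.zpowers τ = Subgroup.closure {I, τ} := by
    rw [Subgroup.zpowers_eq_closure, Subgroup.zpowers_eq_closure, ← Subgroup.closure_union]
    rfl
  have hval : ∀ (n : ℕ) [NeZero n] (x : Multiplicative (ZMod n)), x ≠ 1 →
      x.toAdd.val < n ∧ x.toAdd.val ≠ 0 := fun n _ x hx =>
    ⟨ZMod.val_lt _, fun h => hx ((ZMod.val_eq_zero _).1 h)⟩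
  have hIne : ∀ x : Multiplicative (ZMod 2), x ≠ 1 → zmodPowHom 2 I hI x = I := by
    intro x hx
    obtain ⟨h1, h2⟩ := hval 2 x hx
    change I ^ x.toAdd.val = I
    rw [show x.toAdd.val = 1 by omega, pow_one]
  have hτne : ∀ x : Multiplicative (ZMod 3), x ≠ 1 →
      zmodPowHom 3 τ hτ3 x = τ ∨ zmodPowHom 3 τ hτ3 x = τ ^ 2 := by
    intro x hx
    obtain ⟨h1, h2⟩ := hval 3 x hx
    change τ ^ x.toAdd.val = τ ∨ τ ^ x.toAdd.val = τ ^ 2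
    have h3 : x.toAdd.val = 1 ∨ x.toAdd.val = 2 := by omega
    rcases h3 with h3 | h3
    · left; rw [h3, pow_one]
    · right; rw [h3]
  have : Fact (1 < 3) := ⟨by norm_num⟩
  have : Fact (1 < 2) := ⟨by norm_num⟩
  have hIpow : ∀ x : Subgroup.zpowers I, x ≠ 1 → (x : G) = I := by
    rintro ⟨x, hx⟩ hx1
    rw [← range_zmodPowHom 2 I hI] at hx
    obtain ⟨y, rfl⟩ := hx
    refine hIne y ?_
    rintro rfl
    exact hx1 (Subtype.ext (map_one _))
  have hτpow : ∀ x : Subgroup.zpowers τ, x ≠ 1 → (x : G) = τ ∨ (x : G) = τ ^ 2 := by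
    rintro ⟨x, hx⟩ hx1
    rw [← range_zmodPowHom 3 τ hτ3] at hx
    obtain ⟨y, rfl⟩ := hx
    refine hτne y ?_
    rintro rfl
    exact hx1 (Subtype.ext (map_one _))
  refine ⟨?_, ?_, ?_⟩
  · refine coprod_lift_injective_of_ping_pong _ _ ?_ X Y hX hY hXY ?_ ?_
    · exact ⟨⟨τ, Subgroup.mem_zpowers τ⟩, ⟨τ ^ 2, Subgroup.npow_mem_zpowers τ 2⟩,
        fun h => hτ1 (congrArg Subtype.val h), fun h => hτ2 (congrArg Subtype.val h),
        fun h => hτ12 (congrArg Subtype.val h)⟩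
    · intro x hx p hp
      rw [Subgroup.subtype_apply, hIpow x hx]
      exact hIY p hp
    · intro x hx p hp
      rw [Subgroup.subtype_apply]
      rcases hτpow x hx with h | h <;> rw [h]
      · exact hτX p hp
      · exact hτX2 p hp
  · rw [Monoid.Coprod.range_lift, Subgroup.range_subtype, Subgroup.range_subtype, hcl]
  · have hinj : Function.Injective
        (Monoid.Coprod.lift (zmodPowHom 2 I hI) (zmodPowHom 3 τ hτ3)) := by
      refine coprod_lift_injective_of_ping_pong _ _ ?_ X Y hX hY hXY ?_ ?_
      · exact ⟨Multiplicative.ofAdd 1, Multiplicative.ofAdd 2, by decide, by decide, by decide⟩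
      · intro x hx p hp
        rw [hIne x hx]
        exact hIY p hp
      · intro x hx p hp
        rcases hτne x hx with h | h <;> rw [h]
        · exact hτX p hp
        · exact hτX2 p hp
    have hrange : (Monoid.Coprod.lift (zmodPowHom 2 I hI) (zmodPowHom 3 τ hτ3)).range =
        Subgroup.closure {I, τ} := by
      rw [Monoid.Coprod.range_lift, range_zmodPowHom, range_zmodPowHom, hcl]
    refine ⟨(MonoidHom.ofInjective hinj).trans (MulEquiv.subgroupCongr hrange), ?_, ?_⟩
    · change Monoid.Coprod.lift (zmodPowHom 2 I hI) (zmodPowHom 3 τ hτ3) (Monoid.Coprod.inl _) = I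
      rw [Monoid.Coprod.lift_apply_inl, zmodPowHom_ofAdd_one]
    · change Monoid.Coprod.lift (zmodPowHom 2 I hI) (zmodPowHom 3 τ hτ3) (Monoid.Coprod.inr _) = τ
      rw [Monoid.Coprod.lift_apply_inr, zmodPowHom_ofAdd_one]

/-! ### Deck transformations of order three and the correspondence -/

lemma deriv_chebA (a z : ℂ) : deriv (chebA a) z = (1 - a) * sib a z z := by
  have h1 : HasDerivAt (affA a) ((1 - a) * 1) z :=
    ((hasDerivAt_id z).const_mul (1 - a)).const_add a
  rw [mul_one] at h1
  have h2 := (h1.pow 3).sub (h1.const_mul 3)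
  have h3 : HasDerivAt (chebA a) _ z := h2
  rw [h3.deriv, sib]
  simp only [Nat.cast_ofNat, Nat.add_one_sub_one]
  ring

/-- The divided difference of `f_a` vanishes exactly at the pairs of siblings. -/
lemma dslope_chebA_eq_zero_iff {a : ℂ} (ha : a ≠ 1) (p w : ℂ) :
    dslope (chebA a) p w = 0 ↔ sib a p w = 0 := by
  have h1 : (1 - a) ≠ 0 := sub_ne_zero.2 ha.symm
  rcases eq_or_ne w p with rfl | hne
  · rw [dslope_same, deriv_chebA, mul_eq_zero, or_iff_right h1]
  · rw [dslope_of_ne _ hne, slope_def_field, div_eq_zero_iff, or_iff_left (sub_ne_zero.2 hne),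
      chebA_sub, mul_eq_zero, sib_comm, or_iff_right (mul_ne_zero h1 (sub_ne_zero.2 hne))]

lemma dividedZero_infty_iff {a : ℂ} {w : Sphere} :
    dividedZero a OnePoint.infty w ↔ w = OnePoint.infty := by
  induction w using OnePoint.rec with
  | infty => exact ⟨fun _ => rfl, fun _ => trivial⟩
  | coe w => exact ⟨fun h => h.elim, fun h => (OnePoint.coe_ne_infty w h).elim⟩

lemma not_dividedZero_coe_infty {a p : ℂ} : ¬dividedZero a (p : Sphere) OnePoint.infty :=
  fun h => h

lemma dividedZero_coe_coe {a : ℂ} (ha : a ≠ 1) {p w : ℂ} :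
    dividedZero a (p : Sphere) (w : Sphere) ↔ sib a p w = 0 :=
  dslope_chebA_eq_zero_iff ha p w

lemma chebSphere_eq_of_dividedZero {a : ℂ} (ha : a ≠ 1) {x w : Sphere} (h : dividedZero a x w) :
    chebSphere a w = chebSphere a x := by
  induction x using OnePoint.rec with
  | infty => rw [dividedZero_infty_iff.1 h]
  | coe p =>
    induction w using OnePoint.rec with
    | infty => exact (not_dividedZero_coe_infty h).elim
    | coe w =>
      rw [chebSphere_coe, chebSphere_coe, chebA_eq_of_sib ((dividedZero_coe_coe ha).1 h)]

lemma chebSphere_eq_infty_iff {a : ℂ} {x : Sphere} :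
    chebSphere a x = OnePoint.infty ↔ x = OnePoint.infty := by
  induction x using OnePoint.rec with
  | infty => exact ⟨fun _ => rfl, fun _ => rfl⟩
  | coe z => exact ⟨fun h => (OnePoint.coe_ne_infty _ h).elim,
      fun h => (OnePoint.coe_ne_infty _ h).elim⟩

namespace IsOrderThreeDeck

variable {a : ℂ} {τ : liftedTiling a ≃ₜ liftedTiling a} (hτ : IsOrderThreeDeck a τ)
include hτ

lemma apply_three (x : liftedTiling a) : τ (τ (τ x)) = x := by
  have h1 : τ ^ 3 = 1 := hτ.2 ▸ pow_orderOf_eq_one τ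
  exact DFunLike.congr_fun h1 x

lemma coe_apply_eq_infty_iff (x : liftedTiling a) :
    (τ x : Sphere) = OnePoint.infty ↔ (x : Sphere) = OnePoint.infty := by
  rw [← chebSphere_eq_infty_iff (a := a), hτ.1 x, chebSphere_eq_infty_iff]

/-- A deck transformation of order three has no finite fixed point: its fixed points form a clopen
subset of the preimage of the finite part of the tiling set, which is connected. -/
theorem apply_ne (H : IsUnivalentParam a) (h2 : (2 : ℂ) ∉ finTiling a) {x : liftedTiling a}
    (hx : (x : Sphere) ≠ OnePoint.infty) : τ x ≠ x := by
  have : PreconnectedSpace (chebA a ⁻¹' finTiling a) :=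
    isPreconnected_iff_preconnectedSpace.1 H.isPreconnected_preimage_finTiling
  let j : chebA a ⁻¹' finTiling a → liftedTiling a := fun z =>
    ⟨((z : ℂ) : Sphere), H.coe_mem_liftedTiling.2 z.2⟩
  have hj : Continuous j := (OnePoint.continuous_coe.comp continuous_subtype_val).subtype_mk _
  let F : Set (chebA a ⁻¹' finTiling a) := {z | τ (j z) = j z}
  have hFc : IsClosed F := isClosed_eq (τ.continuous.comp hj) hj
  have hFo : IsOpen F := by
    rw [isOpen_iff_mem_nhds]
    intro z hz
    have hz' : τ (j z) = j z := hz
    obtain ⟨U, hU, hUs⟩ := exists_nhds_sib_ne (H.sib_self_ne_of_mem h2 z.2)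
    have h3 : ((↑) : ℂ → Sphere) '' U ∈ 𝓝 ((z : ℂ) : Sphere) := by
      rw [OnePoint.nhds_coe_eq]; exact image_mem_map hU
    have h4 : Tendsto (fun y => (τ (j y) : Sphere)) (𝓝 z) (𝓝 ((z : ℂ) : Sphere)) := by
      have h5 := (continuous_subtype_val.comp (τ.continuous.comp hj)).tendsto z
      simp only [Function.comp, hz'] at h5
      exact h5
    filter_upwards [h4 h3, continuous_subtype_val.continuousAt hU] with y hy hyU
    obtain ⟨v, hv, hvy⟩ := hy
    have hvy' : (v : Sphere) = (τ (j y) : Sphere) := hvy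
    have hyU' : (y : ℂ) ∈ U := hyU
    have h5 : chebSphere a (τ (j y) : Sphere) = chebSphere a (j y : Sphere) := hτ.1 (j y)
    rw [← hvy'] at h5
    have h6 : chebA a v = chebA a y := OnePoint.coe_injective h5
    have h7 : v = y := by
      by_contra hne
      exact hUs v hv y hyU' (sib_eq_zero H.ne_one h6 hne)
    apply Subtype.ext
    rw [← hvy', h7]
  intro hfix
  obtain ⟨z, hz⟩ := OnePoint.ne_infty_iff_exists.1 hx
  have hzm : chebA a z ∈ finTiling a := H.coe_mem_liftedTiling.1 (hz ▸ x.2)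
  have hjx : j ⟨z, hzm⟩ = x := Subtype.ext hz
  rcases isClopen_iff.1 ⟨hFc, hFo⟩ with h | h
  · have h3 : (⟨z, hzm⟩ : chebA a ⁻¹' finTiling a) ∈ F := by
      change τ (j _) = j _
      rw [hjx, hfix]
    rw [h] at h3
    exact h3
  · have h1 : τ = 1 := by
      ext y
      change (τ y : Sphere) = y
      by_cases hy : (y : Sphere) = OnePoint.infty
      · rw [(hτ.coe_apply_eq_infty_iff y).2 hy, hy]
      · obtain ⟨u, hu⟩ := OnePoint.ne_infty_iff_exists.1 hy
        have hum : chebA a u ∈ finTiling a := H.coe_mem_liftedTiling.1 (hu ▸ y.2)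
        have hjy : j ⟨u, hum⟩ = y := Subtype.ext hu
        have h3 : (⟨u, hum⟩ : chebA a ⁻¹' finTiling a) ∈ F := h ▸ mem_univ _
        have h4 : τ (j _) = j _ := h3
        rw [hjy] at h4
        rw [h4]
    have h3 := hτ.2
    rw [h1, orderOf_one] at h3
    norm_num at h3

lemma apply_apply_ne (H : IsUnivalentParam a) (h2 : (2 : ℂ) ∉ finTiling a) {x : liftedTiling a}
    (hx : (x : Sphere) ≠ OnePoint.infty) : τ (τ x) ≠ x := by
  intro h
  have h3 := hτ.apply_three x
  rw [h] at h3
  exact hτ.apply_ne H h2 hx h3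

/-- The zeros of the divided difference at a point `x` of the lifted tiling set are `τ x` and
`τ² x`. -/
theorem dividedZero_iff (H : IsUnivalentParam a) (h2 : (2 : ℂ) ∉ finTiling a) (x : liftedTiling a)
    (w : Sphere) : dividedZero a x w ↔ (w = (τ x : Sphere) ∨ w = (τ (τ x) : Sphere)) := by
  by_cases hx : (x : Sphere) = OnePoint.infty
  · have h1 := (hτ.coe_apply_eq_infty_iff x).2 hx
    rw [hx, dividedZero_infty_iff, h1, (hτ.coe_apply_eq_infty_iff (τ x)).2 h1, or_self]
  have hx1 := (hτ.coe_apply_eq_infty_iff x).not.2 hx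
  have hx2 := (hτ.coe_apply_eq_infty_iff (τ x)).not.2 hx1
  have hne1 := hτ.apply_ne H h2 hx
  have hne2 := hτ.apply_apply_ne H h2 hx
  have hne12 := hτ.apply_ne H h2 hx1
  have hg1 := hτ.1 x
  have hg2 := hτ.1 (τ x)
  rw [Ne, ← Subtype.coe_inj] at hne1 hne2 hne12
  obtain ⟨p, hp⟩ := OnePoint.ne_infty_iff_exists.1 hx
  obtain ⟨q, hq⟩ := OnePoint.ne_infty_iff_exists.1 hx1
  obtain ⟨r, hr⟩ := OnePoint.ne_infty_iff_exists.1 hx2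
  rw [hg1, ← hr, ← hp] at hg2
  rw [← hp, ← hq] at hg1
  rw [← hp, ← hq, OnePoint.coe_eq_coe] at hne1
  rw [← hp, ← hr, OnePoint.coe_eq_coe] at hne2
  rw [← hq, ← hr, OnePoint.coe_eq_coe] at hne12
  rw [← hp, ← hq, ← hr]
  have hsq : sib a p q = 0 := sib_eq_zero H.ne_one (OnePoint.coe_injective hg1).symm (Ne.symm hne1)
  have hsr : sib a p r = 0 := sib_eq_zero H.ne_one (OnePoint.coe_injective hg2).symm (Ne.symm hne2)
  -- the sibling polynomial of `p` is quadratic, with the distinct roots `q` and `r`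
  have hroot : ∀ v, sib a p v = 0 → v ≠ q → affA a v = -affA a p - affA a q := by
    intro v hv hvq
    have h1 : (affA a v - affA a q) * (affA a p + affA a v + affA a q) = 0 := by
      simp only [sib] at hv hsq
      linear_combination hv - hsq
    have h3 := (mul_eq_zero.1 h1).resolve_left
      (sub_ne_zero.2 ((affA_injective H.ne_one).ne hvq))
    linear_combination h3
  induction w using OnePoint.rec with
  | infty =>
    refine ⟨fun h => (not_dividedZero_coe_infty h).elim, ?_⟩
    rintro (h | h) <;> exact (OnePoint.infty_ne_coe _ h).elim
  | coe w =>
    rw [dividedZero_coe_coe H.ne_one, OnePoint.coe_eq_coe, OnePoint.coe_eq_coe]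
    constructor
    · intro hw
      by_contra! hcon
      exact hcon.2 (affA_injective H.ne_one ((hroot w hw hcon.1).trans (hroot r hsr hne12).symm))
    · rintro (rfl | rfl)
      · exact hsq
      · exact hsr

end IsOrderThreeDeck

/-! ### Grand orbits and the generated group -/

/-- The part of the lifted tiling set in the open unit disk. -/
def diskPart (a : ℂ) : Set (liftedTiling a) := {x | ∃ z : ℂ, ‖z‖ < 1 ∧ (x : Sphere) = z}

/-- The part of the lifted tiling set outside the closed unit disk. -/
def outerPart (a : ℂ) : Set (liftedTiling a) :=
  {x | (x : Sphere) = OnePoint.infty ∨ ∃ z : ℂ, 1 < ‖z‖ ∧ (x : Sphere) = z}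

lemma disjoint_diskPart_outerPart (a : ℂ) : Disjoint (diskPart a) (outerPart a) := by
  rw [disjoint_left]
  rintro x ⟨z, hz, hxz⟩ (h | ⟨w, hw, hxw⟩)
  · rw [hxz] at h; exact OnePoint.coe_ne_infty _ h
  · rw [hxz] at hxw
    rw [OnePoint.coe_injective hxw] at hz
    linarith

namespace IsUnivalentParam

variable {a : ℂ} (H : IsUnivalentParam a)
include H

lemma mem_liftedTiling_iff_of_corr {x w : Sphere} (h : corr a x w) :
    x ∈ liftedTiling a ↔ w ∈ liftedTiling a := by
  have h1 := chebSphere_eq_of_dividedZero H.ne_one h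
  rw [← H.reflect_mem_iff, liftedTiling, mem_preimage, mem_preimage, h1]

theorem corr_iff (h2 : (2 : ℂ) ∉ finTiling a) {τ : liftedTiling a ≃ₜ liftedTiling a}
    (hτ : IsOrderThreeDeck a τ) (z : liftedTiling a) (w : Sphere) :
    corr a (z : Sphere) w ↔
      (w = (τ (H.reflectHomeo z) : Sphere) ∨ w = (τ (τ (H.reflectHomeo z)) : Sphere)) :=
  hτ.dividedZero_iff H h2 (H.reflectHomeo z) w

lemma reflectHomeo_reflectHomeo (z : liftedTiling a) :
    H.reflectHomeo (H.reflectHomeo z) = z := Subtype.ext (reflect_reflect _)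

theorem grandOrbit_eq (h2 : (2 : ℂ) ∉ finTiling a) {τ : liftedTiling a ≃ₜ liftedTiling a}
    (hτ : IsOrderThreeDeck a τ) (z : liftedTiling a) :
    grandOrbit a (z : Sphere) =
      {w | ∃ g ∈ Subgroup.closure {H.reflectHomeo, τ}, w = (g z : Sphere)} := by
  set I := H.reflectHomeo with hIdef
  set G := Subgroup.closure {I, τ} with hG
  have hIG : I ∈ G := Subgroup.subset_closure (mem_insert _ _)
  have hτG : τ ∈ G := Subgroup.subset_closure (mem_insert_of_mem _ rfl)
  have hcorr := H.corr_iff h2 hτ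
  apply Subset.antisymm
  · have key : ∀ x w : Sphere, Relation.EqvGen (corr a) x w →
        (x ∈ liftedTiling a ↔ w ∈ liftedTiling a) ∧
        ∀ (hx : x ∈ liftedTiling a) (hw : w ∈ liftedTiling a), ∃ g ∈ G, g ⟨x, hx⟩ = ⟨w, hw⟩ := by
      intro x w h
      induction h with
      | rel x w h =>
        refine ⟨H.mem_liftedTiling_iff_of_corr h, fun hx hw => ?_⟩
        rcases (hcorr ⟨x, hx⟩ w).1 h with h1 | h1
        · exact ⟨τ * I, mul_mem hτG hIG, Subtype.ext h1.symm⟩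
        · exact ⟨τ * (τ * I), mul_mem hτG (mul_mem hτG hIG), Subtype.ext h1.symm⟩
      | refl x => exact ⟨Iff.rfl, fun hx hw => ⟨1, one_mem _, rfl⟩⟩
      | symm x w _ ih =>
        refine ⟨ih.1.symm, fun hw hx => ?_⟩
        obtain ⟨g, hg, hgx⟩ := ih.2 hx hw
        exact ⟨g⁻¹, inv_mem hg, by rw [← hgx]; exact g.symm_apply_apply _⟩
      | trans x y w _ _ ih1 ih2 =>
        refine ⟨ih1.1.trans ih2.1, fun hx hw => ?_⟩
        obtain ⟨g, hg, hgx⟩ := ih1.2 hx (ih1.1.1 hx)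
        obtain ⟨g', hg', hgx'⟩ := ih2.2 (ih1.1.1 hx) hw
        exact ⟨g' * g, mul_mem hg' hg, by rw [← hgx', ← hgx]; rfl⟩
    intro w hw
    have h1 := key _ _ hw
    obtain ⟨g, hg, hgz⟩ := h1.2 z.2 (h1.1.1 z.2)
    exact ⟨g, hg, congrArg Subtype.val hgz.symm⟩
  · have h1 : ∀ x : liftedTiling a, Relation.EqvGen (corr a) x (τ (I x) : Sphere) :=
      fun x => .rel _ _ ((hcorr x _).2 (Or.inl rfl))
    have h3 : ∀ x : liftedTiling a, Relation.EqvGen (corr a) x (τ (τ (I x)) : Sphere) :=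
      fun x => .rel _ _ ((hcorr x _).2 (Or.inr rfl))
    -- the two images of `I y` lie on the fiber of `y`
    have h4 : ∀ y : liftedTiling a, Relation.EqvGen (corr a) (τ y : Sphere) (τ (τ y) : Sphere) := by
      intro y
      have h5 := h1 (I y)
      have h6 := h3 (I y)
      rw [hIdef, H.reflectHomeo_reflectHomeo] at h5 h6
      exact .trans _ _ _ (.symm _ _ h5) h6
    have hτrel : ∀ y : liftedTiling a, Relation.EqvGen (corr a) (y : Sphere) (τ y : Sphere) := by
      intro y
      have h5 := h4 (τ (τ y))
      rwa [hτ.apply_three] at h5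
    have hIrel : ∀ y : liftedTiling a, Relation.EqvGen (corr a) (y : Sphere) (I y : Sphere) :=
      fun y => .trans _ _ _ (h1 y) (.symm _ _ (hτrel (I y)))
    rintro _ ⟨g, hg, rfl⟩
    have key : ∀ y : liftedTiling a, Relation.EqvGen (corr a) (y : Sphere) (g y : Sphere) := by
      induction hg using Subgroup.closure_induction with
      | mem g hg =>
        rcases hg with rfl | rfl
        · exact hIrel
        · exact hτrel
      | one => exact fun y => .refl _
      | mul g g' _ _ ih ih' => exact fun y => .trans _ _ _ (ih' y) (ih (g' y))
      | inv g _ ih =>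
        intro y
        have h5 := ih (g⁻¹ y)
        rw [show g (g⁻¹ y) = y from g.apply_symm_apply y] at h5
        exact .symm _ _ h5
    exact key z

lemma reflectHomeo_mem_diskPart {x : liftedTiling a} (hx : x ∈ outerPart a) :
    H.reflectHomeo x ∈ diskPart a := by
  rcases hx with h | ⟨z, hz, hxz⟩
  · exact ⟨0, by simp, show reflect _ = _ by rw [h, reflect_infty]⟩
  · have hz0 : z ≠ 0 := norm_pos_iff.1 (by linarith)
    refine ⟨(conj z)⁻¹, ?_, show reflect _ = _ by rw [hxz, reflect_coe hz0]⟩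
    rw [norm_conj_inv]
    exact inv_lt_one_of_one_lt₀ hz

/-- By univalence on the closed disk, the other points of the fiber of a point of the open disk lie
outside the closed disk. -/
lemma mem_outerPart {x y : liftedTiling a} (hx : x ∈ diskPart a)
    (hxy : chebSphere a y = chebSphere a x) (hne : y ≠ x) : y ∈ outerPart a := by
  obtain ⟨z, hz, hxz⟩ := hx
  by_cases hy : (y : Sphere) = OnePoint.infty
  · exact Or.inl hy
  obtain ⟨w, hw⟩ := OnePoint.ne_infty_iff_exists.1 hy
  refine Or.inr ⟨w, ?_, hw.symm⟩
  by_contra hle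
  rw [← hw, hxz] at hxy
  have h1 := H.eq_of_chebA_eq (not_lt.1 hle) hz.le (OnePoint.coe_injective hxy)
  exact hne (Subtype.ext (by rw [← hw, hxz, h1]))

end IsUnivalentParam

end SchwarzFamily

theorem mainTheorem10 (a : ℂ) (ha : a ∈ connLocus) :
    ∃ I : liftedTiling a ≃ₜ liftedTiling a,
      -- `I` is the restriction of the circle reflection to the lifted tiling set
      (∀ z : liftedTiling a, (I z : Sphere) = reflect (z : Sphere)) ∧
      (∃ τ : liftedTiling a ≃ₜ liftedTiling a, IsOrderThreeDeck a τ) ∧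
      ∀ τ : liftedTiling a ≃ₜ liftedTiling a, IsOrderThreeDeck a τ →
        -- on the lifted tiling set the correspondence consists of two maps
        (∀ (z : liftedTiling a) (w : Sphere), corr a (z : Sphere) w ↔
          (w = (τ (I z) : Sphere) ∨ w = (τ (τ (I z)) : Sphere))) ∧
        -- grand orbits are the orbits of the group generated by the reflection and `τ`
        (∀ z : liftedTiling a, grandOrbit a (z : Sphere) =
          {w | ∃ g ∈ Subgroup.closure {I, τ}, w = (g z : Sphere)}) ∧
        -- this group is the internal free product of the two cyclic subgroups
        Function.Injective (Monoid.Coprod.lift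
          (Subgroup.zpowers I).subtype (Subgroup.zpowers τ).subtype) ∧
        (Monoid.Coprod.lift
          (Subgroup.zpowers I).subtype (Subgroup.zpowers τ).subtype).range =
            Subgroup.closure {I, τ} ∧
        -- and it is `ℤ₂ * ℤ₃`, with the reflection and `τ` as the standard generators
        ∃ φ : Monoid.Coprod (Multiplicative (ZMod 2)) (Multiplicative (ZMod 3)) ≃*
            Subgroup.closure {I, τ},
          (φ (Monoid.Coprod.inl (Multiplicative.ofAdd 1)) : liftedTiling a ≃ₜ liftedTiling a)
              = I ∧
          (φ (Monoid.Coprod.inr (Multiplicative.ofAdd 1)) : liftedTiling a ≃ₜ liftedTiling a)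
              = τ := by
  have H := isUnivalentParam_of_mem ha.1
  have h2 : (2 : ℂ) ∉ finTiling a := fun h => ha.2 (H.coe_mem_tilingSet.2 h)
  refine ⟨H.reflectHomeo, fun z => rfl, H.exists_deck h2, fun τ hτ =>
    ⟨H.corr_iff h2 hτ, H.grandOrbit_eq h2 hτ, ?_⟩⟩
  let act : MulAction (liftedTiling a ≃ₜ liftedTiling a) (liftedTiling a) :=
    { smul := fun g x => g x
      one_smul := fun _ => rfl
      mul_smul := fun _ _ _ => rfl }
  have hfin : ∀ x ∈ diskPart a, (x : Sphere) ≠ OnePoint.infty := by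
    rintro x ⟨z, -, hxz⟩
    rw [hxz]
    exact OnePoint.coe_ne_infty z
  refine free_product_of_ping_pong ?_ hτ.2 (diskPart a)
    (outerPart a) ⟨⟨_, H.coe_zero_mem_liftedTiling⟩, 0, by simp, rfl⟩
    ⟨⟨_, IsUnivalentParam.infty_mem_liftedTiling⟩, Or.inl rfl⟩
    (disjoint_diskPart_outerPart a)
    (fun x hx => H.reflectHomeo_mem_diskPart hx)
    (fun x hx => H.mem_outerPart hx (hτ.1 x) (hτ.apply_ne H h2 (hfin x hx)))
    (fun x hx => H.mem_outerPart hx ((hτ.1 (τ x)).trans (hτ.1 x))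
      (hτ.apply_apply_ne H h2 (hfin x hx)))
  ext x
  exact congrArg Subtype.val (H.reflectHomeo_reflectHomeo x)
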